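/- Let $d\ge 2$ be an integer, let $\delta\in[0,1)$, $\gamma>0$, $\lambda<1$ and $c\ge 1$ be real constants, and let $(G_N)_{N\in S}$, $S\subseteq\mathbb N$, be a constructible family of undirected $d$-regular graphs, $G_N$ having vertex set $\{0,\dots,N-1\}$, each with spectral gap $1-\lambda_{G_N}\ge 1-\lambda$. Suppose that for every large enough $N$ there is $N'\in S$ with $N\le N'\le cN$. Put $\alpha:=-\log_d\lambda^2$ and $R:=\max\{\alpha(1-\delta),\,1-\delta/\alpha\}-\gamma$. Then there is a constant $\beta>0$ such that for every large enough $n$ there is a $(\delta n,\,2^{-\beta n},\,0)_d$-resilient wiretap protocol of block length $n$ and rate at least $R$, with encoder and decoder computable in polynomial time given an advice string of polynomial length that depends only on $n$. If moreover an element $N'\in S$ with $N\le N'\le cN$ can be computed from every large enough $N$ in time polynomial in $\log N$ (which is automatic when $c=1$), then no advice is needed: the protocols can be chosen computable by uniform polynomial-time algorithms. Here $\lambda_G$ denotes the second largest absolute value of an eigenvalue (counted with multiplicity) of the normalized adjacency matrix of $G$; graphs may have parallel edges and loops. A family is constructible if the graphs in it have labelings $L_N$ such that, for each vertex $u$, $t\mapsto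 L_N(u,t)$ ($1\le t\le d$) enumerates the neighbours of $u$ with multiplicity, $L_N(u,t)=L_N(v,t)$ implies $u=v$, and $L_N(u,t)$ is computable from $(N,u,t)$ in time polynomial in $\log N$. A $(t,\varepsilon,\kappa)_d$-resilient wiretap protocol of message length $m\ge1$ and block length $n$, for an alphabet $\Sigma$ of size $d$, is a pair of functions $E:\Sigma^m\times\mathbb F_2^r\to\Sigma^n$ and $D:\Sigma^n\to\Sigma^m$ such that (a) $D(E(x,z))=x$ for all $x,z$; (b) if $X\in\Sigma^m$ and $Z\in\mathbb F_2^r$ are uniform and independent and $Y=E(X,Z)$, then for every $T\subseteq\{1,\dots,n\}$ with $|T|\le t$, the probability that the observed value $w=Y|_T$ is such that the distribution of $X$ conditioned on $Y|_T=w$ has statistical distance more than $\varepsilon$ from uniform is at most $\kappa$. Its rate is $m/n$. Polynomial time for $E$ and $D$ means that, along the sequence of protocols, $r$, the advice length and the running times (on input $n$, the advice, and the arguments of the function) are bounded by a polynomial in $m$. -/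

import Mathlib

open Filter

/-! ### Programs with a bit-cost semantics -/

/-- The arithmetic operations on natural numbers (subtraction is truncated; `/` and `%` are
quotient and remainder, with `y / 0 = 0` and `y % 0 = y`). -/
inductive ArithOp where
  | add | sub | mul | div | mod

/-- The value of an arithmetic operation. -/
def ArithOp.eval : ArithOp → ℕ → ℕ → ℕ
  | .add, y, z => y + z
  | .sub, y, z => y - z
  | .mul, y, z => y * z
  | .div, y, z => y / z
  | .mod, y, z => y % z

/-- While-programs over registers `0, 1, 2, …` that hold natural numbers of arbitrary size.
A program mentions finitely many registers. `call P args x` runs the (syntactically smaller, hence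
non-recursive) subroutine `P` on fresh registers initialised with the contents of the registers
`args`, and stores its result in register `x`. -/
inductive Prog where
  | const (x c : ℕ)
  | op (o : ArithOp) (x y z : ℕ)
  | seq (P Q : Prog)
  | ite (x : ℕ) (P Q : Prog)
  | loop (x : ℕ) (P : Prog)
  | call (P : Prog) (args : List ℕ) (x : ℕ)

/-- Contents of all registers. -/
abbrev RegState := ℕ → ℕ

/-- Initial state: the inputs are in registers `0, 1, …`, all other registers hold `0`. -/
def RegState.init (inputs : List ℕ) : RegState := fun i => inputs.getD i 0

/-- `Run P s s' t`: program `P` started in state `s` halts in state `s'` after `t` bit operations.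
An arithmetic operation on operands of bit lengths `a` and `b` costs `(a + 1) * (b + 1)` (which
covers the schoolbook algorithms for all five operations); storing or copying a number costs its
bit length plus one, and a test of a register against zero costs the same. -/
inductive Run : Prog → RegState → RegState → ℕ → Prop
  | const (x c : ℕ) (s : RegState) :
      Run (.const x c) s (Function.update s x c) (Nat.size c + 1)
  | op (o : ArithOp) (x y z : ℕ) (s : RegState) :
      Run (.op o x y z) s (Function.update s x (o.eval (s y) (s z)))
        ((Nat.size (s y) + 1) * (Nat.size (s z) + 1))
  | seq {P Q : Prog} {s s₁ s₂ : RegState} {t₁ t₂ : ℕ} :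
      Run P s s₁ t₁ → Run Q s₁ s₂ t₂ → Run (.seq P Q) s s₂ (t₁ + t₂)
  | ite_true {x : ℕ} {P Q : Prog} {s s₁ : RegState} {t : ℕ} :
      s x ≠ 0 → Run P s s₁ t → Run (.ite x P Q) s s₁ (Nat.size (s x) + 1 + t)
  | ite_false {x : ℕ} {P Q : Prog} {s s₁ : RegState} {t : ℕ} :
      s x = 0 → Run Q s s₁ t → Run (.ite x P Q) s s₁ (Nat.size (s x) + 1 + t)
  | loop_stop {x : ℕ} {P : Prog} {s : RegState} :
      s x = 0 → Run (.loop x P) s s (Nat.size (s x) + 1)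
  | loop_step {x : ℕ} {P : Prog} {s s₁ s₂ : RegState} {t₁ t₂ : ℕ} :
      s x ≠ 0 → Run P s s₁ t₁ → Run (.loop x P) s₁ s₂ t₂ →
      Run (.loop x P) s s₂ (Nat.size (s x) + 1 + t₁ + t₂)
  | call {P : Prog} {args : List ℕ} {x : ℕ} {s s₁ : RegState} {t : ℕ} :
      Run P (RegState.init (args.map s)) s₁ t →
      Run (.call P args x) s (Function.update s x (s₁ 0))
        ((args.map fun i => Nat.size (s i) + 1).sum + t + (Nat.size (s₁ 0) + 1))

/-- `P`, started on the given inputs, halts within `T` bit operations and leaves `out` in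
register `0`. -/
def Prog.ComputesWithin (P : Prog) (inputs : List ℕ) (out T : ℕ) : Prop :=
  ∃ (s : RegState) (t : ℕ), Run P (RegState.init inputs) s t ∧ t ≤ T ∧ s 0 = out

/-- The number whose base-`q` digits (least significant first) form the word `w`. -/
def wordCode {q k : ℕ} (w : Fin k → Fin q) : ℕ := ∑ i, (w i : ℕ) * q ^ (i : ℕ)

/-! ### Regular graphs, labelings, spectral gap -/

/-- An undirected `d`-regular graph on the vertex set `Fin N`; parallel edges and loops are allowed
(`mult u v` is the number of edges from `u` to `v`, each undirected edge being regarded as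
two directed ones). A simple `d`-regular graph is the case of an adjacency matrix `mult` with zero
diagonal and entries in `{0, 1}`. -/
structure RegularGraph (d N : ℕ) where
  mult : Fin N → Fin N → ℕ
  symm : ∀ u v, mult u v = mult v u
  regular : ∀ u, ∑ v, mult u v = d

namespace RegularGraph

variable {d N : ℕ}

/-- The normalized adjacency matrix. -/
noncomputable def normAdj (G : RegularGraph d N) : Matrix (Fin N) (Fin N) ℝ :=
  Matrix.of fun u v => (G.mult u v : ℝ) / d

theorem normAdj_isHermitian (G : RegularGraph d N) : G.normAdj.IsHermitian := by
  ext u v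
  simp [normAdj, G.symm u v]

/-- `λ_G`, the second largest absolute value of an eigenvalue of the normalized adjacency matrix,
counted with multiplicity. `eigenvalues₀` lists the eigenvalues in non-increasing order; the one
with index `0` is the trivial eigenvalue `1`, which has the largest absolute value.
(For `N ≤ 1` there is no second eigenvalue and the value is `0`.) -/
noncomputable def secondEigenvalue (G : RegularGraph d N) : ℝ :=
  ⨆ i : {i : Fin (Fintype.card (Fin N)) // 0 < (i : ℕ)},
    |G.normAdj_isHermitian.eigenvalues₀ i.1|

/-- The spectral gap `1 - λ_G`. -/
noncomputable def spectralGap (G : RegularGraph d N) : ℝ := 1 - G.secondEigenvalue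

/-- `L` is a consistent labeling of the edges of `G`: the labels enumerate, for each vertex `u`, the
edges leaving `u`, and `L u t = L v t` only if `u = v`. -/
def IsConsistentLabeling (G : RegularGraph d N) (L : Fin N → Fin d → Fin N) : Prop :=
  (∀ u v, Nat.card {t : Fin d // L u t = v} = G.mult u v) ∧
    ∀ t u v, L u t = L v t → u = v

end RegularGraph

/-- The family `(G N)_{N ∈ S}` is constructible: its members have consistent labelings
`L N`, and one program computes `L N u t` from `(N, u, t)` in time polynomial in the bit length
of `N`. -/
def IsConstructible {d : ℕ} (S : Set ℕ) (G : ∀ N, RegularGraph d N) : Prop :=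
  ∃ L : ∀ N, Fin N → Fin d → Fin N,
    (∀ N ∈ S, (G N).IsConsistentLabeling (L N)) ∧
    ∃ (P : Prog) (p : Polynomial ℕ), ∀ N ∈ S, ∀ (u : Fin N) (t : Fin d),
      P.ComputesWithin [N, u, t] (L N u t) (p.eval (Nat.size N))

/-- For every large `N`, `S` has an element in `[N, c N]`. -/
def HasAllSizesUpTo (S : Set ℕ) (c : ℝ) : Prop :=
  ∀ᶠ N : ℕ in atTop, ∃ N' ∈ S, N ≤ N' ∧ (N' : ℝ) ≤ c * N

/-- An element of `S` in `[N, c N]` can be computed from every large `N` in time polynomial in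
the bit length of `N`. -/
def SizesLocatable (S : Set ℕ) (c : ℝ) : Prop :=
  ∃ (loc : ℕ → ℕ) (P : Prog) (p : Polynomial ℕ), ∀ᶠ N : ℕ in atTop,
    (loc N ∈ S ∧ N ≤ loc N ∧ (loc N : ℝ) ≤ c * N) ∧
      P.ComputesWithin [N] (loc N) (p.eval (Nat.size N))

/-! ### Wiretap protocols -/

/-- Probability of an event under the uniform distribution on a finite set. -/
noncomputable def unifProb {Ω : Type} [Fintype Ω] (A : Ω → Prop) : ℝ :=
  (Nat.card {ω // A ω} : ℝ) / Fintype.card Ω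

/-- Statistical distance of two distributions on a finite set. -/
noncomputable def statDist {Ω : Type} [Fintype Ω] (p q : Ω → ℝ) : ℝ :=
  (1 / 2) * ∑ ω, |p ω - q ω|

section Wiretap

variable {d m n r : ℕ}

/-- The distribution of the message `X` conditioned on the observation `Y|_S = w`, where `X` and the
random bits `Z` are uniform and independent and `Y = E(X, Z)`. (It is only relevant for
observations `w` of positive probability; for the other ones it is `0`.) -/
noncomputable def posterior (E : (Fin m → Fin d) → (Fin r → Fin 2) → (Fin n → Fin d))
    (S : Finset (Fin n)) (w : S → Fin d) (x : Fin m → Fin d) : ℝ :=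
  unifProb (fun ω : (Fin m → Fin d) × (Fin r → Fin 2) =>
      ω.1 = x ∧ (fun i : S => E ω.1 ω.2 i) = w) /
    unifProb (fun ω : (Fin m → Fin d) × (Fin r → Fin 2) => (fun i : S => E ω.1 ω.2 i) = w)

/-- The observation `w` on `S` is bad: the posterior distribution of the message has statistical
distance more than `ε` from uniform. -/
def IsBadObservation (E : (Fin m → Fin d) → (Fin r → Fin 2) → (Fin n → Fin d)) (ε : ℝ)
    (S : Finset (Fin n)) (w : S → Fin d) : Prop :=
  ε < statDist (posterior E S w) (fun _ => 1 / (Fintype.card (Fin m → Fin d) : ℝ))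

/-- The encoder `E` (taking a message and `r` random bits) and the decoder `D` satisfy the
decodability and resiliency conditions of a `(t, ε, κ)_d`-resilient wiretap protocol with message
length `m` and block length `n`. -/
def IsResilientWiretap (E : (Fin m → Fin d) → (Fin r → Fin 2) → (Fin n → Fin d))
    (D : (Fin n → Fin d) → (Fin m → Fin d)) (t ε κ : ℝ) : Prop :=
  (∀ x z, D (E x z) = x) ∧
    ∀ S : Finset (Fin n), (S.card : ℝ) ≤ t →
      unifProb (fun ω : (Fin m → Fin d) × (Fin r → Fin 2) =>
        IsBadObservation E ε S (fun i : S => E ω.1 ω.2 i)) ≤ κ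

end Wiretap

/-- The encoders `E n` and decoders `D n` are computable, for large `n`, in time polynomial in the
message length `m n`, by one program each, which is given the block length `n` and an advice
string `a n` of length polynomial in `m n`; the number `r n` of random bits is polynomial in `m n`
as well. The constant advice `a n = 0` gives computability in
(uniform) polynomial time. -/
def PolyTimeWithAdvice {d : ℕ} (a m r : ℕ → ℕ)
    (E : ∀ n, (Fin (m n) → Fin d) → (Fin (r n) → Fin 2) → (Fin n → Fin d))
    (D : ∀ n, (Fin n → Fin d) → (Fin (m n) → Fin d)) : Prop :=
  ∃ (PE PD : Prog) (p : Polynomial ℕ), ∀ᶠ n : ℕ in atTop,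
    Nat.size (a n) ≤ p.eval (m n) ∧ r n ≤ p.eval (m n) ∧
    (∀ x z, PE.ComputesWithin [n, a n, wordCode x, wordCode z] (wordCode (E n x z))
      (p.eval (m n))) ∧
    ∀ y, PD.ComputesWithin [n, a n, wordCode y] (wordCode (D n y)) (p.eval (m n))

/-- There are wiretap protocols over an alphabet of size `d`, one of each large block length `n`,
that are `(δ n, 2^{-Ω(n)}, 0)_d`-resilient, have rate at least `R`, and are computable in
polynomial time with the advice `a`. -/
def HasWiretapProtocols (d : ℕ) (δ R : ℝ) (a : ℕ → ℕ) : Prop :=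
  ∃ (m r : ℕ → ℕ)
    (E : ∀ n, (Fin (m n) → Fin d) → (Fin (r n) → Fin 2) → (Fin n → Fin d))
    (D : ∀ n, (Fin n → Fin d) → (Fin (m n) → Fin d)),
    PolyTimeWithAdvice a m r E D ∧
    ∃ β : ℝ, 0 < β ∧ ∀ᶠ n : ℕ in atTop,
      0 < m n ∧ R ≤ (m n : ℝ) / n ∧
        IsResilientWiretap (E n) (D n) (δ * n) ((2 : ℝ) ^ (-(β * n))) 0

/-! Choose a rational `p / q` between `max R 0` and the maximum of the two bounds, put `m = ⌊n p /
q⌋`, and choose a constant `k` with `c < d ^ k`. Then some graph of the family has `N` vertices with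
`d ^ m ≤ N ≤ d ^ (m + k)`, and messages become vertices. The encoder walks backwards from the
message for `s = n - m - k` random labels. It outputs the final vertex, written with `m + k` digits
after a random multiple of `N` has been added where there is room, followed by the labels in reverse
order. The decoder retraces the walk (`walk_walkBack`).

For secrecy, fix an observation and count, for each start vertex `v`, the random numbers producing
it. The count is obtained from a function `g` on end vertices by one averaging step per label. An
observed label acts as a permutation, because the labeling is consistent, and preserves the
deviation from the mean. An unobserved label applies `d` times the normalized adjacency matrix and
contracts the relative squared deviation by `θ = lam ^ 2` (`walkSum_deviation_le`). If `a` of the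
`t` observed positions lie in the vertex part, then `f = s - (t - a)` labels are free, and
Cauchy–Schwarz bounds the relative `L¹` deviation of the counts by the square root of `d ^ (3k + a)
* θ ^ f` (`sum_abs_agreeCount_sub_le`). This holds for every observation, so none is bad and `κ =
0`.

Since `d ^ a * θ ^ f = d ^ (a - α f)`, it remains to bound `a - α f`. As `α ≤ 1`, it increases with
`a` for fixed `t`; the bounds `a ≤ m + k` and `a ≤ t` yield the two terms of the maximum
(`exponent_le`). That `α ≤ 1` follows from `θ ≥ 1/d - 1/N` (`inv_sub_inv_le_sq`) on arbitrarily
large graphs. Random bits in place of random digits cost only an exponentially small error, because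
the encoder is periodic in its random number.

For efficiency, a backward step needs only the `d` neighbours of a vertex, since the graph is
undirected. The only nonuniform datum is the size `N`; it serves as the advice, or is computed when
sizes are locatable. -/

/-! ### A cost-aware program logic -/

/-- Started in `s`, the program `P` halts within `T` bit operations in a state satisfying `Q`. -/
def RunsTo (P : Prog) (s : RegState) (T : ℕ) (Q : RegState → Prop) : Prop :=
  ∃ s' t, Run P s s' t ∧ t ≤ T ∧ Q s'

theorem computesWithin_iff {P : Prog} {l : List ℕ} {out T : ℕ} :
    P.ComputesWithin l out T ↔ RunsTo P (RegState.init l) T fun s => s 0 = out := Iff.rfl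

namespace RunsTo

variable {P P' : Prog} {s : RegState} {T T' B x y z : ℕ} {Q Q' : RegState → Prop}

theorem mono (h : RunsTo P s T Q) (hT : T ≤ T') (hQ : ∀ s, Q s → Q' s) : RunsTo P s T' Q' := by
  obtain ⟨s', t, h1, h2, h3⟩ := h
  exact ⟨s', t, h1, h2.trans hT, hQ _ h3⟩

/-- With one common bound `B` on bit lengths, every basic instruction is charged the same `(B + 1) ^
2`, so cost estimates reduce to counting instructions. -/
theorem const {c : ℕ} (hc : c < 2 ^ B) (h : Q (Function.update s x c)) :
    RunsTo (.const x c) s ((B + 1) ^ 2) Q := by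
  refine ⟨_, _, Run.const x c s, ?_, h⟩
  have := Nat.size_le.2 hc
  nlinarith

theorem op {o : ArithOp} (hy : s y < 2 ^ B) (hz : s z < 2 ^ B)
    (h : Q (Function.update s x (o.eval (s y) (s z)))) :
    RunsTo (.op o x y z) s ((B + 1) ^ 2) Q := by
  refine ⟨_, _, Run.op o x y z s, ?_, h⟩
  rw [sq]
  exact Nat.mul_le_mul (Nat.succ_le_succ (Nat.size_le.2 hy)) (Nat.succ_le_succ (Nat.size_le.2 hz))

theorem seq (h : RunsTo P s T fun s₁ => RunsTo P' s₁ T' Q) : RunsTo (.seq P P') s (T + T') Q := by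
  obtain ⟨s', t, h1, h2, s'', t', h3, h4, h5⟩ := h
  exact ⟨_, _, Run.seq h1 h3, by omega, h5⟩

theorem ite (hx : s x < 2 ^ B) (h₁ : s x ≠ 0 → RunsTo P s T Q) (h₂ : s x = 0 → RunsTo P' s T Q) :
    RunsTo (.ite x P P') s (T + (B + 1) ^ 2) Q := by
  have hB := Nat.size_le.2 hx
  have : Nat.size (s x) + 1 ≤ (B + 1) ^ 2 := by nlinarith
  by_cases h : s x = 0
  · obtain ⟨s', t, g1, g2, g3⟩ := h₂ h
    exact ⟨_, _, Run.ite_false h g1, by omega, g3⟩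
  · obtain ⟨s', t, g1, g2, g3⟩ := h₁ h
    exact ⟨_, _, Run.ite_true h g1, by omega, g3⟩

/-- The invariant is indexed by the value of the loop register, which counts down. Thus the number
of rounds is known in advance, and termination and cost come from one induction; the additional
round pays for the final test. -/
theorem loop (I : ℕ → RegState → Prop) {k : ℕ} (hk : k < 2 ^ B)
    (hI : ∀ i s, I i s → s x = i)
    (hstep : ∀ i s, i < k → I (i + 1) s → RunsTo P s T (I i)) (h : I k s) :
    RunsTo (.loop x P) s ((k + 1) * (T + (B + 1))) (I 0) := by
  induction k generalizing s with
  | zero =>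
    have h0 := hI _ _ h
    refine ⟨_, _, Run.loop_stop h0, ?_, h⟩
    simp [h0]; omega
  | succ k ih =>
    have h0 := hI _ _ h
    obtain ⟨s₁, t₁, g1, g2, g3⟩ := hstep k s (Nat.lt_succ_self k) h
    obtain ⟨s₂, t₂, f1, f2, f3⟩ := ih (by omega) (fun i s hi => hstep i s (by omega)) g3
    refine ⟨_, _, Run.loop_step (by omega) g1 f1, ?_, f3⟩
    have : Nat.size (s x) ≤ B := Nat.size_le.2 (h0 ▸ hk)
    calc Nat.size (s x) + 1 + t₁ + t₂ ≤ B + 1 + T + (k + 1) * (T + (B + 1)) := by omega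
      _ = (k + 1 + 1) * (T + (B + 1)) := by ring

theorem call {args : List ℕ} {v : ℕ}
    (h : P.ComputesWithin (args.map s) v T)
    (hargs : ∀ i ∈ args, s i < 2 ^ B) (hv : v < 2 ^ B) (hQ : Q (Function.update s x v)) :
    RunsTo (.call P args x) s (T + (args.length + 1) * (B + 1)) Q := by
  obtain ⟨s', t, g1, g2, g3⟩ := h
  refine ⟨_, _, Run.call g1, ?_, by rw [g3]; exact hQ⟩
  have h1 : (args.map fun i => Nat.size (s i) + 1).sum ≤ args.length * (B + 1) := by
    have := List.sum_le_card_nsmul (args.map fun i => Nat.size (s i) + 1) (B + 1) (by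
      intro a ha
      obtain ⟨i, hi, rfl⟩ := List.mem_map.1 ha
      exact Nat.succ_le_succ (Nat.size_le.2 (hargs i hi)))
    simpa using this
  have h2 : Nat.size (s' 0) ≤ B := Nat.size_le.2 (g3 ▸ hv)
  rw [add_mul]
  omega

end RunsTo

theorem Prog.ComputesWithin.mono {P : Prog} {l : List ℕ} {out T T' : ℕ}
    (h : P.ComputesWithin l out T) (hT : T ≤ T') : P.ComputesWithin l out T' :=
  RunsTo.mono (computesWithin_iff.1 h) hT fun _ h => h

/-! ### Functions bounded by polynomials -/

/-- `f` is bounded by a polynomial. -/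
def PolyBounded (f : ℕ → ℕ) : Prop := ∃ p : Polynomial ℕ, ∀ n, f n ≤ p.eval n

theorem Polynomial.eval_mono_nat (p : Polynomial ℕ) {a b : ℕ} (h : a ≤ b) :
    p.eval a ≤ p.eval b := by
  rw [Polynomial.eval_eq_sum, Polynomial.eval_eq_sum]
  exact Finset.sum_le_sum fun i _ => Nat.mul_le_mul_left _ (Nat.pow_le_pow_left h i)

namespace PolyBounded

variable {f g : ℕ → ℕ}

theorem const (c : ℕ) : PolyBounded fun _ => c := ⟨Polynomial.C c, fun n => by simp⟩

theorem id : PolyBounded fun n => n := ⟨Polynomial.X, fun n => by simp⟩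

theorem add (hf : PolyBounded f) (hg : PolyBounded g) : PolyBounded fun n => f n + g n := by
  obtain ⟨p, hp⟩ := hf
  obtain ⟨q, hq⟩ := hg
  exact ⟨p + q, fun n => by simpa using Nat.add_le_add (hp n) (hq n)⟩

theorem mul (hf : PolyBounded f) (hg : PolyBounded g) : PolyBounded fun n => f n * g n := by
  obtain ⟨p, hp⟩ := hf
  obtain ⟨q, hq⟩ := hg
  exact ⟨p * q, fun n => by simpa using Nat.mul_le_mul (hp n) (hq n)⟩

theorem pow (hf : PolyBounded f) (k : ℕ) : PolyBounded fun n => f n ^ k := by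
  obtain ⟨p, hp⟩ := hf
  exact ⟨p ^ k, fun n => by simpa using Nat.pow_le_pow_left (hp n) k⟩

theorem eval (hf : PolyBounded f) (p : Polynomial ℕ) : PolyBounded fun n => p.eval (f n) := by
  obtain ⟨q, hq⟩ := hf
  exact ⟨p.comp q, fun n => by simpa using p.eval_mono_nat (hq n)⟩

end PolyBounded

/-! ### Arithmetic of the encoder and the decoder -/

/-- Walk backwards from `v` along the labels given by the lowest `s` base-`d` digits of `z`;
`τ t` is the inverse of the step with label `t`. -/
def walkBack {V : Type} (d : ℕ) (τ : ℕ → V → V) : ℕ → V → ℕ → V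
  | 0, v, _ => v
  | s + 1, v, z => walkBack d τ s (τ (z % d) v) (z / d)

/-- Walk along the labels given by the lowest `s` base-`d` digits of `c`. -/
def walk (d : ℕ) (L : ℕ → ℕ → ℕ) : ℕ → ℕ → ℕ → ℕ
  | 0, u, _ => u
  | s + 1, u, c => walk d L s (L u (c % d)) (c / d)

/-- Push the lowest `s` base-`d` digits of `z` onto `acc`. -/
def pushDigits (d : ℕ) : ℕ → ℕ → ℕ → ℕ
  | 0, _, acc => acc
  | s + 1, z, acc => pushDigits d s (z / d) (acc * d + z % d)

/-- A number below `D` that is congruent to `u` modulo `N`. -/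
def blowUp (N D u b : ℕ) : ℕ := if u + N * b < D then u + N * b else u

/-- The code of the codeword of `x` for the random number `z`. -/
def encNat (d N m k s : ℕ) (τ : ℕ → ℕ → ℕ) (x z : ℕ) : ℕ :=
  blowUp N (d ^ (m + k)) (walkBack d τ s x z) (z / d ^ s % d ^ k) +
    d ^ (m + k) * pushDigits d s z 0

/-- The code of the message decoded from the word with code `y`. -/
def decNat (d N m k s : ℕ) (L : ℕ → ℕ → ℕ) (y : ℕ) : ℕ :=
  walk d L s (y % d ^ (m + k) % N) (y / d ^ (m + k)) % d ^ m

theorem pushDigits_lt {d : ℕ} (hd : 0 < d) (s z acc j : ℕ) (h : acc < d ^ j) :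
    pushDigits d s z acc < d ^ (s + j) := by
  induction s generalizing z acc j with
  | zero => simpa [pushDigits] using h
  | succ s ih =>
    have := ih (z / d) (acc * d + z % d) (j + 1) (by
      have := Nat.mod_lt z hd
      have : (acc + 1) * d ≤ d ^ j * d := Nat.mul_le_mul_right _ h
      rw [pow_succ]; linarith)
    rw [pushDigits, show s + 1 + j = s + (j + 1) by ring]
    exact this

theorem pushDigits_div {d : ℕ} (hd : 0 < d) (s z acc : ℕ) :
    pushDigits d s z acc / d ^ s = acc := by
  induction s generalizing z acc with
  | zero => simp [pushDigits]
  | succ s ih =>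
    rw [pushDigits, pow_succ, ← Nat.div_div_eq_div_mul, ih, mul_comm, Nat.mul_add_div hd,
      Nat.div_eq_of_lt (Nat.mod_lt _ hd), add_zero]

theorem pushDigits_digit {d : ℕ} (hd : 0 < d) (s z acc j : ℕ) (hj : j < s) :
    pushDigits d s z acc / d ^ j % d = z / d ^ (s - 1 - j) % d := by
  induction s generalizing z acc with
  | zero => omega
  | succ s ih =>
    rw [pushDigits]
    rcases Nat.lt_succ_iff_lt_or_eq.1 hj with h | rfl
    · rw [ih _ _ h, Nat.div_div_eq_div_mul, ← pow_succ']
      congr 3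
      omega
    · rw [pushDigits_div hd]
      simp

/-- Pushing digits reverses their order, so the label used last on the way back is read first on the
way forward. The extra `j` and `acc` stand for steps already pushed and make the induction go
through. -/
theorem walk_walkBack {d N : ℕ} (hd : 0 < d) {L τ : ℕ → ℕ → ℕ}
    (hτ : ∀ t < d, ∀ v < N, τ t v < N ∧ L (τ t v) t = v) (s j v z acc : ℕ) (hv : v < N) :
    walk d L (s + j) (walkBack d τ s v z) (pushDigits d s z acc) = walk d L j v acc := by
  induction s generalizing j v z acc with
  | zero => simp [walkBack, pushDigits]
  | succ s ih =>
    obtain ⟨h1, h2⟩ := hτ (z % d) (Nat.mod_lt _ hd) v hv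
    rw [walkBack, pushDigits, show s + 1 + j = s + (j + 1) by ring, ih _ _ _ _ h1, walk]
    rw [mul_comm acc, Nat.mul_add_mod, Nat.mod_mod, h2, Nat.mul_add_div hd,
      Nat.div_eq_of_lt (Nat.mod_lt _ hd), add_zero]

theorem walkBack_lt {d N : ℕ} (hd : 0 < d) {τ : ℕ → ℕ → ℕ}
    (hτ : ∀ t < d, ∀ v < N, τ t v < N) (s v z : ℕ) (hv : v < N) : walkBack d τ s v z < N := by
  induction s generalizing v z with
  | zero => exact hv
  | succ s ih => exact ih _ _ (hτ _ (Nat.mod_lt _ hd) _ hv)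

theorem blowUp_lt {N D u b : ℕ} (hu : u < D) : blowUp N D u b < D := by
  unfold blowUp
  split_ifs <;> assumption

theorem blowUp_mod {N D u b : ℕ} (hu : u < N) : blowUp N D u b % N = u := by
  unfold blowUp
  split_ifs <;> simp [Nat.mod_eq_of_lt hu]

theorem encNat_lt {d N m k s : ℕ} (hd : 0 < d) {τ : ℕ → ℕ → ℕ}
    (hτ : ∀ t < d, ∀ v < N, τ t v < N) (hN : N ≤ d ^ (m + k)) {x : ℕ} (hx : x < N) (z : ℕ) :
    encNat d N m k s τ x z < d ^ (m + k + s) := by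
  have h1 := blowUp_lt (N := N) (b := z / d ^ s % d ^ k)
    ((walkBack_lt hd hτ s x z hx).trans_le hN)
  have h2 := pushDigits_lt hd s z 0 0 (by simp)
  rw [add_zero] at h2
  have h3 : d ^ (m + k) * (pushDigits d s z 0 + 1) ≤ d ^ (m + k) * d ^ s :=
    Nat.mul_le_mul_left _ h2
  rw [encNat, pow_add _ (m + k)]
  linarith

theorem decNat_encNat {d N m k s : ℕ} (hd : 0 < d) {L τ : ℕ → ℕ → ℕ}
    (hτ : ∀ t < d, ∀ v < N, τ t v < N ∧ L (τ t v) t = v) (hN : N ≤ d ^ (m + k)) {x : ℕ}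
    (hx : x < N) (hx' : x < d ^ m) (z : ℕ) :
    decNat d N m k s L (encNat d N m k s τ x z) = x := by
  have hu := walkBack_lt hd (fun t ht v hv => (hτ t ht v hv).1) s x z hx
  have h1 := blowUp_lt (N := N) (b := z / d ^ s % d ^ k) (hu.trans_le hN)
  have hD : 0 < d ^ (m + k) := Nat.pow_pos hd
  rw [decNat, encNat, Nat.add_mul_mod_self_left, Nat.mod_eq_of_lt h1, blowUp_mod hu,
    Nat.add_mul_div_left _ _ hD, Nat.div_eq_of_lt h1, zero_add]
  have := walk_walkBack hd hτ s 0 x z 0 hx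
  rw [add_zero] at this
  rw [this, walk, Nat.mod_eq_of_lt hx']

/-! ### The programs -/

/-- Computes `d ^ m` from `m`. -/
def powProg (d : ℕ) : Prog :=
  .seq (.const 1 1) <| .seq (.const 2 d) <| .seq (.const 3 1) <|
  .seq (.loop 0 (.seq (.op .mul 1 1 2) (.op .sub 0 0 3))) <| .op .add 0 0 1

theorem powProg_spec {d m B : ℕ} (hd : 2 ≤ d) (hB : d ^ (m + 1) < 2 ^ B) :
    (powProg d).ComputesWithin [m] (d ^ m) ((m + 6) * (3 * (B + 1) ^ 2)) := by
  have hm : m < d ^ m := Nat.lt_pow_self (by omega)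
  have hle : ∀ i ≤ m + 1, d ^ i < 2 ^ B := fun i hi =>
    (Nat.pow_le_pow_right (by omega) hi).trans_lt hB
  have h1 : 1 < 2 ^ B := by
    have := hle 0 (by omega)
    have := hle 1 (by omega)
    rw [pow_one] at this
    omega
  have hd' : d < 2 ^ B := by simpa using hle 1 (by omega)
  have hmB : m < 2 ^ B := hm.trans (hle m (by omega))
  rw [computesWithin_iff]
  refine RunsTo.mono (T := (B + 1) ^ 2 + ((B + 1) ^ 2 + ((B + 1) ^ 2 +
    ((m + 1) * (((B + 1) ^ 2 + (B + 1) ^ 2) + (B + 1)) + (B + 1) ^ 2)))) ?_ ?_ fun _ h => h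
  · refine .seq <| .const h1 <| .seq <| .const hd' <| .seq <| .const h1 <| .seq <|
      .mono (.loop (fun i s => s 0 = i ∧ i ≤ m ∧ s 1 = d ^ (m - i) ∧ s 2 = d ∧ s 3 = 1) hmB
        (fun i s h => h.1) ?_ ?_) le_rfl ?_
    · rintro i s hi ⟨h0, him, h1', h2, h3⟩
      refine .seq <| .op (B := B) (by rw [h1']; exact hle _ (by omega)) (by rwa [h2]) <|
        .op (B := B) ?_ ?_ ?_
      · simp [h0]; omega
      · simpa [Function.update_apply, h3] using h1
      · simp [ArithOp.eval, h0, h1', h2, h3]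
        refine ⟨by omega, ?_⟩
        rw [← pow_succ]
        congr 1
        omega
    · simp [RegState.init]
    · rintro s ⟨h0, -, h1', h2, h3⟩
      refine .op (B := B) ?_ ?_ ?_
      · rw [h0]; omega
      · rw [h1']; exact hle _ (by omega)
      · simp [ArithOp.eval, h0, h1']
  · have : B + 1 ≤ (B + 1) ^ 2 := Nat.le_self_pow (by omega) _
    nlinarith

/-- Given a program `P` for the function `L N u t`, finds from `N`, `v`, `t` a neighbour `u` of `v`
with `L N u t = v`. -/
def invProg (d : ℕ) (P : Prog) : Prog :=
  .seq (.const 3 d) <| .seq (.const 8 1) <|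
  .seq (.loop 3 <|
    .seq (.op .sub 3 3 8) <| .seq (.call P [0, 1, 3] 4) <| .seq (.call P [0, 4, 2] 5) <|
    .seq (.op .sub 6 5 1) <| .seq (.op .sub 7 1 5) <| .seq (.op .add 6 6 7) <|
    .ite 6 (.const 7 0) (.op .add 9 4 7)) <|
  .seq (.const 0 0) <| .op .add 0 0 9

/-- Searching all `N` vertices would be exponential in `n`. By `hτ'`, which comes from the symmetry
of the graph, some neighbour of `v` is the predecessor of `v` along label `t`, so `d` trials
suffice; `hτ` makes any hit the right one. -/
theorem invProg_spec {d N B T : ℕ} {P : Prog} {L τ : ℕ → ℕ → ℕ}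
    (hP : ∀ u < N, ∀ t < d, P.ComputesWithin [N, u, t] (L u t) T ∧ L u t < N)
    (hτ : ∀ t < d, ∀ u < N, τ t (L u t) = u)
    (hτ' : ∀ t < d, ∀ v < N, ∃ j < d, L (L v j) t = v)
    (hN : N < 2 ^ B) (hdB : d < 2 ^ B) {v t : ℕ} (hv : v < N) (ht : t < d) :
    (invProg d P).ComputesWithin [N, v, t] (τ t v)
      ((d + 5) * (2 * T + 15 * (B + 2) ^ 2)) := by
  have h1 : 1 < 2 ^ (B + 1) := Nat.one_lt_pow (by omega) (by omega)
  have hBB : 2 ^ (B + 1) = 2 ^ B + 2 ^ B := by ring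
  rw [computesWithin_iff]
  set C := (B + 1 + 1) ^ 2 with hC
  have hB' : B + 1 + 1 ≤ C := Nat.le_self_pow (by omega) _
  refine RunsTo.mono (T := C + (C + ((d + 1) * ((C + ((T + 4 * (B + 1 + 1)) +
    ((T + 4 * (B + 1 + 1)) + (C + (C + (C + (C + C))))))) + (B + 1 + 1)) + (C + C)))) ?_ ?_
    fun _ h => h
  · refine .seq <| .const (by omega) <| .seq <| .const h1 <| .seq <|
      .mono (.loop (fun i s => s 0 = N ∧ s 1 = v ∧ s 2 = t ∧ s 3 = i ∧ s 8 = 1 ∧ s 9 < N ∧ i ≤ d ∧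
        ((∃ j, i ≤ j ∧ j < d ∧ L (L v j) t = v) → L (s 9) t = v)) (by omega)
        (fun i s h => h.2.2.2.1) ?_ ?_) le_rfl ?_
    · rintro i s hi ⟨s0, s1, s2, s3, s8, s9, hid, hres⟩
      obtain ⟨r1, r2⟩ := hP v hv i hi
      obtain ⟨r3, r4⟩ := hP _ r2 t ht
      refine .seq <| .op (B := B + 1) (by omega) (by omega) <| .seq <|
        .call (B := B + 1) (v := L v i) (T := T) ?_ ?_ ?_ <| .seq <|
        .call (B := B + 1) (v := L (L v i) t) (T := T) ?_ ?_ ?_ <| .seq <|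
        .op (B := B + 1) ?_ ?_ <| .seq <| .op (B := B + 1) ?_ ?_ <| .seq <|
        .op (B := B + 1) ?_ ?_ <| .ite (B := B + 1) ?_ (fun h6 => .const ?_ ?_)
        (fun h6 => .op ?_ ?_ ?_)
      · simpa [Function.update_apply, ArithOp.eval, s0, s1, s2, s3, s8] using r1
      · simp [Function.update_apply, ArithOp.eval, s0, s1, s3, s8]; omega
      · omega
      · simpa [Function.update_apply, ArithOp.eval, s0, s1, s2, s3, s8] using r3
      · simp [Function.update_apply, ArithOp.eval, s0, s2]; omega
      · omega
      all_goals
        simp +decide only [Function.update_apply, ArithOp.eval, s0, s1, s2, s3, s8, if_true,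
          if_false, Nat.add_sub_cancel] at *
      any_goals omega
      · refine ⟨trivial, trivial, trivial, trivial, trivial, s9, hi.le, ?_⟩
        rintro ⟨j, hj1, hj2, hj3⟩
        rcases hj1.eq_or_lt with rfl | hlt
        · omega
        · exact hres ⟨j, hlt, hj2, hj3⟩
      -- The equality test adds the two truncated differences. When it succeeds, register `7` holds
      -- `0`, so adding it merely copies register `4`.
      · have e : L v i + (v - L (L v i) t) = L v i := by omega
        rw [e]
        exact ⟨trivial, trivial, trivial, trivial, trivial, r2, hi.le, fun _ => by omega⟩
    · simp [RegState.init]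
      refine ⟨by omega, fun j h1 h2 => by omega⟩
    · rintro s ⟨s0, s1, s2, s3, s8, s9, -, hres⟩
      refine .seq <| .const (B := B + 1) (by omega) <| .op (B := B + 1) ?_ ?_ ?_
      · simp
      · simp; omega
      · obtain ⟨j, hj, hj'⟩ := hτ' t ht v hv
        have := hτ t ht _ s9
        rw [hres ⟨j, by omega, hj, hj'⟩] at this
        simp [ArithOp.eval, this]
  · nlinarith

/-- Computes from the block length `n` in register `0` the message length `m = n * p / q` and the
numbers that depend on it, and continues with `P`. -/
def withParams (p q k d : ℕ) (P : Prog) : Prog :=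
  .seq (.const 4 p) <| .seq (.op .mul 4 0 4) <| .seq (.const 5 q) <| .seq (.op .div 4 4 5) <|
  .seq (.call (powProg d) [4] 13) <| .seq (.const 5 (d ^ k)) <| .seq (.op .mul 6 13 5) <|
  .seq (.const 7 k) <| .seq (.op .add 4 4 7) <| .seq (.op .sub 4 0 4) <| .seq (.const 8 d) <|
  .seq (.const 9 1) P

theorem withParams_spec {p q k d n m s B T : ℕ} {P : Prog} {st : RegState} {Q : RegState → Prop}
    (hd : 2 ≤ d) (hm : m = n * p / q) (hn : n = m + k + s) (hB : d ^ (n + k + 1) < 2 ^ B)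
    (hnp : n * p < 2 ^ B) (hp : p < 2 ^ B) (hq : q < 2 ^ B) (h0 : st 0 = n)
    (h : ∀ st' : RegState, st' 1 = st 1 → st' 2 = st 2 → st' 3 = st 3 → st' 4 = s →
      st' 5 = d ^ k → st' 6 = d ^ (m + k) → st' 8 = d → st' 9 = 1 → st' 11 = st 11 →
      st' 13 = d ^ m → RunsTo P st' T Q) :
    RunsTo (withParams p q k d P) st (T + (m + 20) * (3 * (B + 1) ^ 2)) Q := by
  have hle : ∀ i ≤ n + k + 1, d ^ i < 2 ^ B := fun i hi =>
    (Nat.pow_le_pow_right (by omega) hi).trans_lt hB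
  have hlt : ∀ i ≤ n + k + 1, i < 2 ^ B := fun i hi =>
    (Nat.lt_pow_self (by omega)).trans (hle i hi)
  have hd' : d < 2 ^ B := by simpa using hle 1 (by omega)
  have h1 : 1 < 2 ^ B := by omega
  have hnB := hlt n (by omega)
  have hmB := hlt m (by omega)
  have hkB := hlt k (by omega)
  have hmkB := hlt (m + k) (by omega)
  have hdk := hle k (by omega)
  have hdm := hle m (by omega)
  set C := (B + 1) ^ 2 with hC
  have hB' : B + 1 ≤ C := Nat.le_self_pow (by omega) _
  refine RunsTo.mono (T := C + (C + (C + (C + (((m + 6) * (3 * C) + 2 * (B + 1)) + (C + (C +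
    (C + (C + (C + (C + (C + T)))))))))))) ?_ ?_ fun _ h => h
  · refine .seq <| .const hp <| .seq <| .op (B := B) ?_ ?_ <| .seq <| .const hq <| .seq <|
      .op (B := B) ?_ ?_ <| .seq <| .call (B := B) (v := d ^ m) (T := (m + 6) * (3 * C)) ?_ ?_ hdm <|
      .seq <| .const hdk <| .seq <| .op (B := B) ?_ ?_ <| .seq <| .const hkB <| .seq <|
      .op (B := B) ?_ ?_ <| .seq <| .op (B := B) ?_ ?_ <| .seq <| .const hd' <|
      .seq <| .const h1 <| h _ ?_ ?_ ?_ ?_ ?_ ?_ ?_ ?_ ?_ ?_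
    all_goals simp [Function.update_apply, ArithOp.eval, h0, ← hm]
    any_goals omega
    · exact powProg_spec hd (hle _ (by omega))
    · rw [pow_add]
  · nlinarith

/-- The encoder, for a program `P` that computes the labeling. The inputs are the block length, the
number of vertices, the message and the random number. -/
def encProg (p q k d : ℕ) (P : Prog) : Prog :=
  withParams p q k d <|
  .seq (.loop 4 <|
    .seq (.op .mod 10 3 8) <| .seq (.op .div 3 3 8) <| .seq (.call (invProg d P) [1, 2, 10] 2) <|
    .seq (.op .mul 11 11 8) <| .seq (.op .add 11 11 10) <| .op .sub 4 4 9) <|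
  .seq (.op .mod 10 3 5) <| .seq (.op .mul 10 1 10) <| .seq (.op .add 10 2 10) <|
  .seq (.op .add 12 10 9) <| .seq (.op .sub 12 12 6) <|
  .seq (.ite 12 (.const 7 0) (.op .add 2 10 12)) <|
  .seq (.op .mul 11 11 6) <| .op .add 0 2 11

theorem encProg_spec {p q k d n m s B N T : ℕ} {P : Prog} {L τ : ℕ → ℕ → ℕ}
    (hd : 2 ≤ d) (hm : m = n * p / q) (hn : n = m + k + s) (hB : d ^ (n + k + 1) < 2 ^ B)
    (hnp : n * p < 2 ^ B) (hp : p < 2 ^ B) (hq : q < 2 ^ B) (hN : N ≤ d ^ (m + k))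
    (hP : ∀ u < N, ∀ t < d, P.ComputesWithin [N, u, t] (L u t) T ∧ L u t < N)
    (hτ : ∀ t < d, ∀ u < N, τ t (L u t) = u) (hτN : ∀ t < d, ∀ v < N, τ t v < N)
    (hτ' : ∀ t < d, ∀ v < N, ∃ j < d, L (L v j) t = v)
    {x z : ℕ} (hx : x < N) (hz : z < 2 ^ B) :
    (encProg p q k d P).ComputesWithin [n, N, x, z] (encNat d N m k s τ x z)
      ((s + 1) * ((d + 5) * (2 * T + 15 * (B + 2) ^ 2) + 10 * (B + 2) ^ 2) +
        (m + 30) * (3 * (B + 2) ^ 2)) := by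
  have hle : ∀ i ≤ n + k + 1, d ^ i < 2 ^ B := fun i hi =>
    (Nat.pow_le_pow_right (by omega) hi).trans_lt hB
  have hlt : ∀ i ≤ n + k + 1, i < 2 ^ B := fun i hi =>
    (Nat.lt_pow_self (by omega)).trans (hle i hi)
  have hd' : d < 2 ^ B := by simpa using hle 1 (by omega)
  have hmkB := hle (m + k) (by omega)
  have hNB : N < 2 ^ B := hN.trans_lt hmkB
  have hdk := hle k (by omega)
  have hBB : 2 ^ (B + 1) = 2 ^ B + 2 ^ B := by ring
  have hsB := hlt s (by omega)
  have hd0 : 0 < d := by omega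
  rw [computesWithin_iff]
  set C := (B + 2) ^ 2 with hC
  have hB' : B + 1 + 1 ≤ C := Nat.le_self_pow (by omega) _
  set TI := (d + 5) * (2 * T + 15 * C) with hTI
  set TT := (s + 1) * ((C + (C + ((TI + 4 * (B + 1 + 1)) + (C + (C + C))))) + (B + 1 + 1)) +
    (C + (C + (C + (C + (C + ((C + C) + (C + C))))))) with hTT
  refine RunsTo.mono (T := TT + (m + 20) * (3 * (B + 1) ^ 2)) ?_ ?_ fun _ h => h
  · refine withParams_spec hd hm hn hB hnp hp hq (by simp [RegState.init]) ?_
    intro st t1 t2 t3 t4 t5 t6 t8 t9 t11 t13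
    simp only [RegState.init, List.getD_cons_succ, List.getD_cons_zero, List.getD_nil] at t1 t2 t3 t11
    -- The invariant says that the remaining `i` steps, run on the current registers, produce the
    -- final values of the whole computation. The bit bound is `B + 1` because `u + N * b + 1`,
    -- formed after the loop, may need one bit more than `B`.
    refine .seq <| .mono (.loop (B := B + 1) (fun i st => st 1 = N ∧ st 4 = i ∧ st 5 = d ^ k ∧
      st 6 = d ^ (m + k) ∧ st 8 = d ∧ st 9 = 1 ∧ i ≤ s ∧ st 2 < N ∧ st 3 ≤ z ∧
      st 11 < d ^ (s - i) ∧ walkBack d τ i (st 2) (st 3) = walkBack d τ s x z ∧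
      st 3 / d ^ i = z / d ^ s ∧ pushDigits d i (st 3) (st 11) = pushDigits d s z 0) (by omega)
      (fun i s h => h.2.1) ?_ ?_) le_rfl ?_
    · rintro i st hi ⟨s1, s4, s5, s6, s8, s9, his, s2, s3, s11, hw, hdiv, hpush⟩
      have ht := Nat.mod_lt (st 3) hd0
      have h11 : st 11 * d + st 3 % d < d ^ (s - i) := by
        have : (st 11 + 1) * d ≤ d ^ (s - (i + 1)) * d := Nat.mul_le_mul_right _ s11
        rw [← pow_succ, show s - (i + 1) + 1 = s - i by omega] at this
        linarith
      have h11' := h11.trans (hle (s - i) (by omega))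
      have h11'' : st 11 < 2 ^ B := s11.trans (hle _ (by omega))
      have hτ1 := hτN _ ht _ s2
      refine .seq <| .op (B := B + 1) ?_ ?_ <| .seq <| .op (B := B + 1) ?_ ?_ <| .seq <|
        .call (B := B + 1) (v := τ (st 3 % d) (st 2)) (T := TI) ?_ ?_ ?_ <| .seq <|
        .op (B := B + 1) ?_ ?_ <| .seq <| .op (B := B + 1) ?_ ?_ <| .op (B := B + 1) ?_ ?_ ?_
      all_goals try simp +decide only [Function.update_apply, ArithOp.eval, s1, s4, s5, s6, s8, s9,
        if_true, if_false, Nat.add_sub_cancel, List.map, List.mem_cons, forall_eq_or_imp,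
        List.not_mem_nil, false_imp_iff, implies_true, and_true, true_and]
      any_goals omega
      · exact invProg_spec hP hτ hτ' hNB hd' s2 ht
      · refine ⟨hi.le, hτ1, (Nat.div_le_self _ _).trans s3, h11, hw, ?_, hpush⟩
        rw [Nat.div_div_eq_div_mul, ← pow_succ', hdiv]
    · simp [t1, t2, t3, t4, t5, t6, t8, t9, t11, hx]
    · rintro st ⟨s1, s4, s5, s6, s8, s9, his, s2, s3, s11, hw, hdiv, hpush⟩
      simp only [walkBack, pushDigits, pow_zero, Nat.div_one, Nat.sub_zero] at hw hdiv hpush s11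
      have hb := Nat.mod_lt (z / d ^ s) (Nat.pow_pos hd0 : 0 < d ^ k)
      set b := z / d ^ s % d ^ k with hbdef
      have h3 : z / d ^ s < 2 ^ (B + 1) := by rw [← hdiv]; omega
      -- This product may reach `d ^ (m + 2 * k)`, which is why `hB` leaves room for powers of `d`
      -- with exponents beyond `n`.
      have hNb : N * b < 2 ^ B := calc
        N * b ≤ d ^ (m + k) * d ^ k := Nat.mul_le_mul hN hb.le
        _ = d ^ (m + k + k) := by rw [← pow_add]
        _ < 2 ^ B := hle _ (by omega)
      rw [hw] at s2
      rw [hpush] at s11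
      have hmul : pushDigits d s z 0 * d ^ (m + k) < 2 ^ B := calc
        _ ≤ d ^ s * d ^ (m + k) := Nat.mul_le_mul_right _ s11.le
        _ = d ^ (s + (m + k)) := by rw [← pow_add]
        _ < 2 ^ B := hle _ (by omega)
      have h11 : pushDigits d s z 0 < 2 ^ B := s11.trans (hle _ (by omega))
      have hbu : blowUp N (d ^ (m + k)) (walkBack d τ s x z) b < d ^ (m + k) :=
        blowUp_lt (s2.trans_le hN)
      refine .seq <| .op (B := B + 1) ?_ ?_ <| .seq <| .op (B := B + 1) ?_ ?_ <| .seq <|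
        .op (B := B + 1) ?_ ?_ <| .seq <| .op (B := B + 1) ?_ ?_ <| .seq <|
        .op (B := B + 1) ?_ ?_ <| .seq <| RunsTo.mono (Q := fun st =>
          st 2 = blowUp N (d ^ (m + k)) (walkBack d τ s x z) b ∧
          st 11 = pushDigits d s z 0 ∧ st 6 = d ^ (m + k))
          (.ite (B := B + 1) ?_ (fun h12 => .const (B := B + 1) ?_ ?_)
          (fun h12 => .op (B := B + 1) ?_ ?_ ?_)) le_rfl ?_
      rotate_right
      · rintro st ⟨r2, r11, r6⟩
        refine .seq <| .op (B := B + 1) ?_ ?_ <| .op (B := B + 1) ?_ ?_ ?_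
        all_goals try simp +decide only [Function.update_apply, ArithOp.eval, r2, r11, r6,
          if_true, if_false]
        any_goals omega
        rw [encNat, mul_comm (d ^ (m + k)), ← hbdef]
      all_goals try simp +decide only [Function.update_apply, ArithOp.eval, s1, s5, s6, s8, s9, hw, hdiv,
        hpush, ← hbdef, if_true, if_false, and_true] at *
      any_goals omega
      -- Register `12` holds the truncated difference of `u + N * b + 1` and `d ^ (m + k)`, which
      -- vanishes exactly when `u + N * b` fits. In that case adding register `12` is again a copy.
      · rw [blowUp, if_neg (by omega)]
      · rw [blowUp, if_pos (by omega)]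
        omega
  · have : (B + 1) ^ 2 ≤ C := Nat.pow_le_pow_left (by omega) _
    have : (m + 20) * (3 * (B + 1) ^ 2) ≤ (m + 20) * (3 * C) :=
      Nat.mul_le_mul_left _ (Nat.mul_le_mul_left _ this)
    rw [hTT]
    nlinarith

/-- The decoder, for a program `P` that computes the labeling. The inputs are the block length, the
number of vertices and the received word. -/
def decProg (p q k d : ℕ) (P : Prog) : Prog :=
  withParams p q k d <|
  .seq (.op .div 3 2 6) <| .seq (.op .mod 2 2 6) <| .seq (.op .mod 2 2 1) <|
  .seq (.loop 4 <|
    .seq (.op .mod 10 3 8) <| .seq (.op .div 3 3 8) <| .seq (.call P [1, 2, 10] 2) <|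
    .op .sub 4 4 9) <|
  .op .mod 0 2 13

theorem decProg_spec {p q k d n m s B N T : ℕ} {P : Prog} {L : ℕ → ℕ → ℕ}
    (hd : 2 ≤ d) (hm : m = n * p / q) (hn : n = m + k + s) (hB : d ^ (n + k + 1) < 2 ^ B)
    (hnp : n * p < 2 ^ B) (hp : p < 2 ^ B) (hq : q < 2 ^ B) (hN0 : 0 < N) (hN : N ≤ d ^ (m + k))
    (hP : ∀ u < N, ∀ t < d, P.ComputesWithin [N, u, t] (L u t) T ∧ L u t < N)
    {y : ℕ} (hy : y < d ^ n) :
    (decProg p q k d P).ComputesWithin [n, N, y] (decNat d N m k s L y)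
      ((s + 1) * (T + 10 * (B + 2) ^ 2) + (m + 30) * (3 * (B + 2) ^ 2)) := by
  have hle : ∀ i ≤ n + k + 1, d ^ i < 2 ^ B := fun i hi =>
    (Nat.pow_le_pow_right (by omega) hi).trans_lt hB
  have hlt : ∀ i ≤ n + k + 1, i < 2 ^ B := fun i hi =>
    (Nat.lt_pow_self (by omega)).trans (hle i hi)
  have hd' : d < 2 ^ B := by simpa using hle 1 (by omega)
  have hmkB := hle (m + k) (by omega)
  have hmB := hle m (by omega)
  have hyB := hy.trans (hle n (by omega))
  have hNB : N < 2 ^ B := hN.trans_lt hmkB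
  have hsB := hlt s (by omega)
  have hd0 : 0 < d := by omega
  have hD : 0 < d ^ (m + k) := Nat.pow_pos hd0
  rw [computesWithin_iff]
  set C := (B + 2) ^ 2 with hC
  have hBC : (B + 1) ^ 2 ≤ C := Nat.pow_le_pow_left (by omega) _
  set C' := (B + 1) ^ 2 with hC'
  have hB' : B + 1 ≤ C' := Nat.le_self_pow (by omega) _
  set TT := C' + (C' + (C' + ((s + 1) * ((C' + (C' + ((T + 4 * (B + 1)) + C'))) + (B + 1)) + C')))
    with hTT
  refine RunsTo.mono (T := TT + (m + 20) * (3 * C')) ?_ ?_ fun _ h => h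
  · refine withParams_spec hd hm hn hB hnp hp hq (by simp [RegState.init]) ?_
    intro st t1 t2 t3 t4 t5 t6 t8 t9 t11 t13
    simp only [RegState.init, List.getD_cons_succ, List.getD_cons_zero, List.getD_nil] at t1 t2 t3 t11
    have hdiv : y / d ^ (m + k) ≤ y := Nat.div_le_self _ _
    have hmod := Nat.mod_lt y hD
    have hmod' := Nat.mod_lt (y % d ^ (m + k)) hN0
    refine .seq <| .op (B := B) ?_ ?_ <| .seq <| .op (B := B) ?_ ?_ <| .seq <| .op (B := B) ?_ ?_ <|
      .seq <| .mono (.loop (B := B) (fun i st => st 1 = N ∧ st 4 = i ∧ st 8 = d ∧ st 9 = 1 ∧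
      st 13 = d ^ m ∧ st 2 < N ∧ st 3 ≤ y ∧ i ≤ s ∧ walk d L i (st 2) (st 3) =
        walk d L s (y % d ^ (m + k) % N) (y / d ^ (m + k))) hsB
      (fun i s h => h.2.1) ?_ ?_) le_rfl ?_
    rotate_right 3
    · rintro i st hi ⟨s1, s4, s8, s9, s13, s2, s3, his, hw⟩
      have ht := Nat.mod_lt (st 3) hd0
      obtain ⟨hL, hL'⟩ := hP _ s2 _ ht
      refine .seq <| .op (B := B) ?_ ?_ <| .seq <| .op (B := B) ?_ ?_ <| .seq <|
        .call (B := B) (v := L (st 2) (st 3 % d)) (T := T) ?_ ?_ ?_ <| .op (B := B) ?_ ?_ ?_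
      all_goals try simp +decide only [Function.update_apply, ArithOp.eval, s1, s4, s8, s9, s13,
        if_true, if_false, Nat.add_sub_cancel, List.map, List.mem_cons, forall_eq_or_imp,
        List.not_mem_nil, false_imp_iff, implies_true, and_true, true_and]
      any_goals omega
      · exact ⟨hL', (Nat.div_le_self _ _).trans s3, hi.le, hw⟩
    · simp [ArithOp.eval, t1, t2, t4, t6, t8, t9, t13, hdiv, hmod']
    · rintro st ⟨s1, s4, s8, s9, s13, s2, s3, his, hw⟩
      rw [walk] at hw
      refine .op (B := B) (by omega) (by omega) ?_
      simp [ArithOp.eval, s13, hw, decNat]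
    all_goals simp +decide only [Function.update_apply, ArithOp.eval, t1, t2, t6, if_true, if_false]
    all_goals omega
  · have : (m + 20) * (3 * C') ≤ (m + 20) * (3 * C) :=
      Nat.mul_le_mul_left _ (Nat.mul_le_mul_left _ hBC)
    rw [hTT]
    nlinarith

/-- Computes a size `N` of a graph with `d ^ (n * p / q)` or more vertices by the program `P`, and
runs `P'` with `N` in the place of the advice. -/
def withLocatedSize (p q d : ℕ) (P P' : Prog) (args : List ℕ) : Prog :=
  .seq (.const 4 p) <| .seq (.op .mul 4 0 4) <| .seq (.const 5 q) <| .seq (.op .div 4 4 5) <|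
  .seq (.call (powProg d) [4] 4) <| .seq (.call P [4] 1) <| .call P' args 0

/-- At most two arguments follow the advice, so registers `4` and `5` are free for scratch work. The
advice `a` is arbitrary, since register `1` is overwritten by the located size. -/
theorem withLocatedSize_spec {p q d n m B N T T' a out : ℕ} {P P' : Prog} {args : List ℕ}
    (hd : 2 ≤ d) (hm : m = n * p / q) (hB : d ^ (m + 1) < 2 ^ B) (hn : n < 2 ^ B)
    (hnp : n * p < 2 ^ B) (hp : p < 2 ^ B) (hq : q < 2 ^ B) (hNB : N < 2 ^ B)
    (hout : out < 2 ^ B)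
    (hargs : ∀ x ∈ args, x < 2 ^ B)
    (hP : P.ComputesWithin [d ^ m] N T) (hargs' : args.length ≤ 2)
    (hP' : P'.ComputesWithin (n :: N :: args) out T') :
    (withLocatedSize p q d P P' ((List.range (args.length + 2)))).ComputesWithin (n :: a :: args) out
      (T + T' + (m + 20) * (3 * (B + 1) ^ 2)) := by
  have hdm : d ^ m < 2 ^ B := (Nat.pow_le_pow_right (by omega) (by omega)).trans_lt hB
  have hmB : m < 2 ^ B := (Nat.lt_pow_self (by omega)).trans hdm
  set C := (B + 1) ^ 2 with hC
  have hB' : B + 1 ≤ C := Nat.le_self_pow (by omega) _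
  rw [computesWithin_iff]
  refine RunsTo.mono (T := C + (C + (C + (C + (((m + 6) * (3 * C) + 2 * (B + 1)) +
    ((T + 2 * (B + 1)) + (T' + (args.length + 2 + 1) * (B + 1)))))))) ?_ ?_ fun _ h => h
  · have hl : (List.range (args.length + 2)).length = args.length + 2 := by simp
    nth_rw 2 [← hl]
    refine .seq <| .const hp <| .seq <| .op (B := B) ?_ ?_ <| .seq <| .const hq <| .seq <|
      .op (B := B) ?_ ?_ <| .seq <| .call (B := B) (v := d ^ m) (T := (m + 6) * (3 * C)) ?_ ?_ hdm <|
      .seq <| .call (B := B) (v := N) (T := T) ?_ ?_ hNB <|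
      .call (B := B) (v := out) (T := T') ?_ ?_ hout ?_
    all_goals simp only [Function.update_apply, ArithOp.eval, RegState.init]
    · simpa using hn
    · simpa using hp
    · simpa using hnp
    · simpa using hq
    · simpa [← hm] using powProg_spec hd hB
    · simpa [← hm] using hmB
    · simpa using hP
    · simpa using hdm
    · convert hP' using 1
      rcases args with _ | ⟨x, _ | ⟨y, _ | ⟨w, l⟩⟩⟩
      · simp [List.range_succ, RegState.init]
      · simp [List.range_succ, RegState.init]
      · simp [List.range_succ, RegState.init]
      · simp at hargs'
    · rcases args with _ | ⟨x, _ | ⟨y, _ | ⟨w, l⟩⟩⟩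
      · simp [List.range_succ, hn, hNB]
      · simpa [List.range_succ, RegState.init, hn, hNB] using hargs
      · simpa [List.range_succ, RegState.init, hn, hNB] using hargs
      · simp at hargs'
    · simp
  · have : (args.length + 2 + 1) * (B + 1) ≤ 5 * C := Nat.mul_le_mul (by omega) hB'
    nlinarith

/-! ### The spectral gap -/

namespace RegularGraph

variable {d N : ℕ}

/-- Expand in an orthonormal eigenbasis. The eigenvectors of positive index have eigenvalues of
modulus at most `lam`; the remaining one contributes nothing, because `g` is orthogonal to the
constants and the constants turn out to be multiples of that eigenvector. -/
theorem sum_sq_mulVec_normAdj_le (G : RegularGraph d N) (hd : 0 < d) {lam : ℝ} (hlam : lam < 1)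
    (hgap : 1 - lam ≤ G.spectralGap) (g : Fin N → ℝ) (hg : ∑ v, g v = 0) :
    ∑ v, (G.normAdj.mulVec g v) ^ 2 ≤ lam ^ 2 * ∑ v, g v ^ 2 := by
  set A := G.normAdj with hA
  have hH := G.normAdj_isHermitian
  set e := hH.eigenvectorBasis with he
  set c : Fin N → (Fin N → ℝ) → ℝ := fun i f => e i ⬝ᵥ f with hc
  have hinner : ∀ i f, inner ℝ (e i) (WithLp.toLp 2 f) = c i f := by
    intro i f
    simp [hc, EuclideanSpace.inner_eq_star_dotProduct, dotProduct_comm]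
  have hparseval : ∀ f, ∑ v, f v ^ 2 = ∑ i, c i f ^ 2 := by
    intro f
    have h1 := e.sum_sq_inner_right (WithLp.toLp 2 f)
    rw [EuclideanSpace.real_norm_sq_eq] at h1
    simp only [hinner] at h1
    exact h1.symm
  have hpars : ∀ f f', f ⬝ᵥ f' = ∑ i, c i f * c i f' := by
    intro f f'
    have h1 := e.sum_inner_mul_inner (WithLp.toLp 2 f) (WithLp.toLp 2 f')
    have h2 : inner ℝ (WithLp.toLp 2 f) (WithLp.toLp 2 f') = f ⬝ᵥ f' := by
      rw [EuclideanSpace.inner_eq_star_dotProduct]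
      simp [dotProduct_comm]
    rw [h2] at h1
    rw [← h1]
    refine Finset.sum_congr rfl fun i _ => ?_
    rw [← hinner, ← hinner, real_inner_comm]
  have hT : A.transpose = A := by simpa using hH.eq
  have hmul : ∀ i f, c i (A.mulVec f) = hH.eigenvalues i * c i f := by
    intro i f
    have h1 := hH.mulVec_eigenvectorBasis i
    simp only [hc]
    rw [Matrix.dotProduct_mulVec, ← Matrix.mulVec_transpose, hT, h1, smul_dotProduct, smul_eq_mul]
  have hone : A.mulVec (fun _ => 1) = fun _ => 1 := by
    ext u
    have : ∑ v, (G.mult u v : ℝ) = d := by exact_mod_cast G.regular u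
    simp [hA, normAdj, Matrix.mulVec, dotProduct, ← Finset.sum_div, this, hd.ne']
  -- The eigenbasis is indexed by vertices, whereas `secondEigenvalue` uses the ordered list
  -- `eigenvalues₀`; this is the reindexing in the definition of `eigenvalues`.
  set idx : Fin N → Fin (Fintype.card (Fin N)) :=
    fun i => (Fintype.equivOfCardEq (Fintype.card_fin _)).symm i with hidx
  have hev : ∀ i, hH.eigenvalues i = hH.eigenvalues₀ (idx i) := fun i => rfl
  have hbound : ∀ i, 0 < (idx i : ℕ) → |hH.eigenvalues i| ≤ lam := by
    intro i hi
    have h1 : |hH.eigenvalues₀ (idx i)| ≤ G.secondEigenvalue :=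
      le_ciSup (f := fun i : {i : Fin (Fintype.card (Fin N)) // 0 < (i : ℕ)} =>
        |hH.eigenvalues₀ i.1|) (Set.finite_range _).bddAbove ⟨idx i, hi⟩
    unfold spectralGap at hgap
    rw [hev]
    linarith
  -- The constant function has eigenvalue `1 > lam`, so it is orthogonal to these eigenvectors. It
  -- is never necessary to show that the eigenvalue of index `0` equals `1`.
  have hc1 : ∀ j, 0 < (idx j : ℕ) → c j (fun _ => 1) = 0 := by
    intro j hj
    have h1 := hmul j (fun _ => 1)
    rw [hone] at h1
    have h2 := (abs_le.1 (hbound j hj)).2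
    have h3 : (1 - hH.eigenvalues j) * c j (fun _ => 1) = 0 := by linarith
    rcases mul_eq_zero.1 h3 with h | h
    · linarith
    · exact h
  have hc0 : ∀ i, (idx i : ℕ) = 0 → c i g = 0 := by
    intro i hi
    have hother : ∀ j, j ≠ i → c j (fun _ => 1) = 0 := by
      intro j hj
      refine hc1 j (Nat.pos_of_ne_zero fun h => hj ?_)
      exact (Equiv.injective _) (Fin.ext (h.trans hi.symm) : idx j = idx i)
    have h1 := hpars g (fun _ => 1)
    rw [Finset.sum_eq_single i (fun j _ hj => by rw [hother j hj, mul_zero])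
      (fun h => absurd (Finset.mem_univ i) h)] at h1
    have h2 := (hparseval (fun _ => 1)).trans (Finset.sum_eq_single i
      (fun j _ hj => by rw [hother j hj]; ring) (fun h => absurd (Finset.mem_univ i) h))
    have h3 : c i (fun _ => 1) ≠ 0 := by
      intro h
      rw [h] at h2
      simp at h2
      exact i.pos.ne' h2
    have h4 : g ⬝ᵥ (fun _ => (1 : ℝ)) = 0 := by simpa [dotProduct] using hg
    rw [h4] at h1
    rcases mul_eq_zero.1 h1.symm with h | h
    · exact h
    · exact absurd h h3
  rw [hparseval (A.mulVec g), hparseval g, Finset.mul_sum]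
  refine Finset.sum_le_sum fun i _ => ?_
  rw [hmul, mul_pow]
  rcases Nat.eq_zero_or_pos (idx i : ℕ) with h | h
  · simp [hc0 i h]
  · refine mul_le_mul_of_nonneg_right ?_ (sq_nonneg _)
    have := hbound i h
    rw [← sq_abs]
    exact pow_le_pow_left₀ (abs_nonneg _) this 2

theorem nonneg_of_le_spectralGap (G : RegularGraph d N) {lam : ℝ}
    (hgap : 1 - lam ≤ G.spectralGap) : 0 ≤ lam := by
  have : 0 ≤ G.secondEigenvalue := Real.iSup_nonneg fun i => abs_nonneg _
  unfold spectralGap at hgap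
  linarith

/-- Test the contraction on a point mass minus its mean. Its squared norm is at most `1`. Its image
has squared norm at least `1/d - 1/N`, because a multiplicity, being a natural number, is at most
its square. -/
theorem inv_sub_inv_le_sq (G : RegularGraph d N) (hd : 0 < d) (hN : 0 < N) {lam : ℝ}
    (hlam : lam < 1) (hgap : 1 - lam ≤ G.spectralGap) :
    1 / (d : ℝ) - 1 / N ≤ lam ^ 2 := by
  have hN' : (0 : ℝ) < N := by exact_mod_cast hN
  have hd' : (0 : ℝ) < d := by exact_mod_cast hd
  set u : Fin N := ⟨0, hN⟩
  set g : Fin N → ℝ := fun v => (if v = u then 1 else 0) - 1 / N with hgdef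
  have hg : ∑ v, g v = 0 := by
    simp [hgdef, Finset.sum_sub_distrib]
    field_simp
    simp
  have h := G.sum_sq_mulVec_normAdj_le hd hlam hgap g hg
  have hrow : ∀ v, ∑ w, (G.mult v w : ℝ) = d := fun v => by exact_mod_cast G.regular v
  have hAg : ∀ v, G.normAdj.mulVec g v = (G.mult u v : ℝ) / d - 1 / N := by
    intro v
    simp only [Matrix.mulVec, dotProduct, normAdj, Matrix.of_apply, hgdef, mul_sub,
      Finset.sum_sub_distrib, mul_ite, mul_one, mul_zero, Finset.sum_ite_eq', Finset.mem_univ,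
      if_true]
    rw [← Finset.sum_mul, ← Finset.sum_div, hrow, div_self hd'.ne', one_mul, G.symm]
  have h1 : ∑ v, g v ^ 2 ≤ 1 := by
    have e : ∀ v, g v ^ 2 = (1 - 2 / N) * (if v = u then 1 else 0) + (1 / N) ^ 2 := by
      intro v
      simp only [hgdef]
      split_ifs <;> ring
    rw [Finset.sum_congr rfl fun v _ => e v, Finset.sum_add_distrib, ← Finset.mul_sum]
    simp
    have : (N : ℝ) * ((N : ℝ) ^ 2)⁻¹ = 1 / N := by field_simp
    rw [this]
    have : 0 ≤ 1 / (N : ℝ) := by positivity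
    have e : 2 / (N : ℝ) = 2 * (1 / N) := by ring
    rw [e]
    linarith
  have h2 : 1 / (d : ℝ) - 1 / N ≤ ∑ v, (G.normAdj.mulVec g v) ^ 2 := by
    have e : ∀ v, (1 / d ^ 2 - 2 / (d * N)) * (G.mult u v : ℝ) + (1 / N) ^ 2 ≤
        (G.normAdj.mulVec g v) ^ 2 := by
      intro v
      rw [hAg]
      have h3 : (G.mult u v : ℝ) ≤ (G.mult u v : ℝ) ^ 2 := by
        exact_mod_cast Nat.le_self_pow two_ne_zero _
      have h4 : (G.mult u v : ℝ) * (1 / d ^ 2) ≤ (G.mult u v : ℝ) ^ 2 * (1 / d ^ 2) :=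
        mul_le_mul_of_nonneg_right h3 (by positivity)
      have h5 : ((G.mult u v : ℝ) / d - 1 / N) ^ 2 = (G.mult u v : ℝ) ^ 2 * (1 / d ^ 2)
        - 2 / (d * N) * (G.mult u v : ℝ) + (1 / N) ^ 2 := by
        field_simp
        ring
      rw [h5]
      linarith
    refine le_trans (le_of_eq ?_) (Finset.sum_le_sum fun v _ => e v)
    rw [Finset.sum_add_distrib, ← Finset.mul_sum, hrow]
    simp
    field_simp
    ring
  have h3 : lam ^ 2 * ∑ v, g v ^ 2 ≤ lam ^ 2 * 1 := mul_le_mul_of_nonneg_left h1 (sq_nonneg _)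
  linarith

/-! ### Consistent labelings: each label permutes the vertices -/

/-- The inverse of the step along the edges labeled `t mod d`. -/
noncomputable def stepBack [NeZero d] (L : Fin N → Fin d → Fin N) (t : ℕ) (v : Fin N) : Fin N :=
  open Classical in if h : ∃ u, L u (Fin.ofNat d t) = v then h.choose else v

theorem IsConsistentLabeling.exists_eq {G : RegularGraph d N} {L : Fin N → Fin d → Fin N}
    (hL : G.IsConsistentLabeling L) (t : Fin d) (v : Fin N) : ∃ u, L u t = v :=
  (Finite.injective_iff_surjective.1 fun _ _ h => hL.2 t _ _ h) v

variable [NeZero d] {G : RegularGraph d N} {L : Fin N → Fin d → Fin N}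

theorem IsConsistentLabeling.apply_stepBack (hL : G.IsConsistentLabeling L) (t : ℕ) (v : Fin N) :
    L (stepBack L t v) (Fin.ofNat d t) = v := by
  rw [stepBack, dif_pos (hL.exists_eq _ _)]
  exact (hL.exists_eq _ _).choose_spec

theorem IsConsistentLabeling.stepBack_apply (hL : G.IsConsistentLabeling L) (t : ℕ) (u : Fin N) :
    stepBack L t (L u (Fin.ofNat d t)) = u :=
  hL.2 _ _ _ (hL.apply_stepBack t _)

theorem IsConsistentLabeling.stepBack_bijective (hL : G.IsConsistentLabeling L) (t : ℕ) :
    Function.Bijective (stepBack L t) :=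
  ⟨fun u v h => by rw [← hL.apply_stepBack t u, h, hL.apply_stepBack],
    fun u => ⟨_, hL.stepBack_apply t u⟩⟩

/-- The edge from the predecessor to `v` can be traversed backwards: `mult` is symmetric, and the
labels at `v` enumerate all edges leaving `v`. -/
theorem IsConsistentLabeling.exists_neighbor (hL : G.IsConsistentLabeling L) (t : ℕ) (v : Fin N) :
    ∃ j, L v j = stepBack L t v := by
  have h1 : 0 < Nat.card {j : Fin d // L (stepBack L t v) j = v} := by
    have : Nonempty {j : Fin d // L (stepBack L t v) j = v} := ⟨⟨_, hL.apply_stepBack t v⟩⟩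
    exact Nat.card_pos
  rw [hL.1, G.symm, ← hL.1] at h1
  obtain ⟨⟨j, hj⟩⟩ := (Nat.card_pos_iff.1 h1).1
  exact ⟨j, hj⟩

/-- This turns a step with a free label into an application of the adjacency matrix, where the
spectral gap acts. -/
theorem IsConsistentLabeling.sum_stepBack (hL : G.IsConsistentLabeling L) (g : Fin N → ℝ)
    (v : Fin N) : ∑ t ∈ Finset.range d, g (stepBack L t v) = d * G.normAdj.mulVec g v := by
  have hd : (d : ℝ) ≠ 0 := by exact_mod_cast NeZero.ne d
  rw [Finset.sum_range]
  have h1 : ∀ t : Fin d, g (stepBack L t v) = ∑ u, if L u t = v then g u else 0 := by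
    intro t
    have ht : Fin.ofNat d (t : ℕ) = t := by ext; simp
    rw [Finset.sum_eq_single (stepBack L t v)]
    · have := hL.apply_stepBack t v
      rw [ht] at this
      rw [if_pos this]
    · intro u _ hu
      rw [if_neg]
      rintro rfl
      have := hL.stepBack_apply t u
      rw [ht] at this
      exact hu this.symm
    · simp
  rw [Finset.sum_congr rfl fun t _ => h1 t, Finset.sum_comm]
  simp only [Matrix.mulVec, dotProduct, normAdj, Matrix.of_apply, Finset.mul_sum]
  refine Finset.sum_congr rfl fun u _ => ?_
  rw [G.symm v u, ← hL.1 u v, Nat.card_eq_fintype_card, Fintype.card_subtype, ← Finset.sum_filter,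
    Finset.sum_const, nsmul_eq_mul]
  field_simp

end RegularGraph

/-! ### Sums over restricted random walks -/

/-- The sum of `g` over all backward walks of length `s` whose `i`-th label lies in `a i`. -/
def walkSum {V : Type} (τ : ℕ → V → V) : ℕ → (ℕ → Finset ℕ) → (V → ℝ) → V → ℝ
  | 0, _, g => g
  | s + 1, a, g => fun v => ∑ t ∈ a 0, walkSum τ s (fun i => a (i + 1)) g (τ t v)

/-- The sum of the squared deviations of `g` from its mean. -/
noncomputable def deviation {V : Type} [Fintype V] (g : V → ℝ) : ℝ :=
  ∑ v, (g v - (∑ u, g u) / Fintype.card V) ^ 2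

theorem deviation_le {V : Type} [Fintype V] [Nonempty V] (g : V → ℝ) :
    deviation g ≤ ∑ v, g v ^ 2 := by
  set μ := (∑ u, g u) / Fintype.card V with hμ
  have h1 : ∑ v, g v = Fintype.card V * μ := by
    rw [hμ]
    field_simp
  have h2 : deviation g = ∑ v, g v ^ 2 - Fintype.card V * μ ^ 2 := by
    unfold deviation
    rw [← hμ]
    simp only [sub_sq, Finset.sum_add_distrib, Finset.sum_sub_distrib, ← Finset.sum_mul,
      ← Finset.mul_sum, h1]
    simp
    ring
  rw [h2]
  have : 0 ≤ (Fintype.card V : ℝ) * μ ^ 2 := by positivity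
  linarith

/-- Each label permutes `V` and preserves the total, so a fixed label changes nothing and a free one
multiplies by `d`. As `d ≥ 2`, a singleton is never mistaken for the full set of labels. -/
theorem walkSum_sum {V : Type} [Fintype V] {d : ℕ} (hd : 2 ≤ d) {τ : ℕ → V → V}
    (hτ : ∀ t, Function.Bijective (τ t)) (g : V → ℝ) (s : ℕ) (a : ℕ → Finset ℕ)
    (ha : ∀ i < s, a i = Finset.range d ∨ ∃ t, a i = {t}) :
    ∑ v, walkSum τ s a g v =
      d ^ (∑ i ∈ Finset.range s, if a i = Finset.range d then 1 else 0) * ∑ v, g v := by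
  induction s generalizing a with
  | zero => simp [walkSum]
  | succ s ih =>
    have h1 := ih (fun i => a (i + 1)) fun i hi => ha (i + 1) (by omega)
    have h2 : ∀ t, ∑ v, walkSum τ s (fun i => a (i + 1)) g (τ t v) =
      ∑ v, walkSum τ s (fun i => a (i + 1)) g v := fun t => (hτ t).sum_comp _
    simp only [walkSum]
    rw [Finset.sum_comm, Finset.sum_congr rfl fun t _ => h2 t, Finset.sum_const, h1,
      Finset.sum_range_succ', nsmul_eq_mul]
    rcases ha 0 (by omega) with h | ⟨t, h⟩
    · rw [if_pos h, h, Finset.card_range, pow_succ]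
      ring
    · have : ({t} : Finset ℕ) ≠ Finset.range d := by
        intro h
        have := congrArg Finset.card h
        simp at this
        omega
      rw [h, if_neg this]
      simp

/-- After subtraction of the mean, a fixed label merely permutes the summands, while a free one
contracts by `hcontr`. Hence observed labels do no harm, whichever steps they belong to. -/
theorem walkSum_deviation_le {V : Type} [Fintype V] [Nonempty V] {d : ℕ} (hd : 2 ≤ d)
    {τ : ℕ → V → V} (hτ : ∀ t, Function.Bijective (τ t)) {θ : ℝ} (hθ : 0 ≤ θ)
    (hcontr : ∀ g : V → ℝ, ∑ v, g v = 0 →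
      ∑ v, (∑ t ∈ Finset.range d, g (τ t v)) ^ 2 ≤ d ^ 2 * θ * ∑ v, g v ^ 2)
    (g : V → ℝ) (s : ℕ) (a : ℕ → Finset ℕ)
    (ha : ∀ i < s, a i = Finset.range d ∨ ∃ t, a i = {t}) :
    deviation (walkSum τ s a g) ≤
      (d ^ 2 * θ) ^ (∑ i ∈ Finset.range s, if a i = Finset.range d then 1 else 0) *
        deviation g := by
  induction s generalizing a with
  | zero => simp [walkSum]
  | succ s ih =>
    have h1 := ih (fun i => a (i + 1)) fun i hi => ha (i + 1) (by omega)
    set f := walkSum τ s (fun i => a (i + 1)) g with hf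
    rw [Finset.sum_range_succ', pow_add]
    set μ := (∑ u, f u) / Fintype.card V with hμ
    have hsum : ∑ v, (f v - μ) = 0 := by
      rw [Finset.sum_sub_distrib, hμ]
      simp
      field_simp
      simp
    have h2 : ∀ t, ∑ v, f (τ t v) = ∑ v, f v := fun t => (hτ t).sum_comp _
    have h3 : walkSum τ (s + 1) a g = fun v => ∑ t ∈ a 0, f (τ t v) := rfl
    have h4 : deviation (fun v => ∑ t ∈ a 0, f (τ t v)) =
        ∑ v, (∑ t ∈ a 0, (f (τ t v) - μ)) ^ 2 := by
      unfold deviation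
      rw [Finset.sum_comm, Finset.sum_congr rfl fun t _ => h2 t]
      refine Finset.sum_congr rfl fun v _ => ?_
      congr 1
      simp only [Finset.sum_sub_distrib, Finset.sum_const, nsmul_eq_mul, hμ]
      ring
    have h5 : deviation f = ∑ v, (f v - μ) ^ 2 := rfl
    rw [h3, h4]
    rcases ha 0 (by omega) with h | ⟨t, h⟩
    · rw [if_pos h, h, pow_one]
      have h6 := hcontr (fun v => f v - μ) hsum
      rw [← h5] at h6
      have h7 : d ^ 2 * θ * deviation f ≤ _ := mul_le_mul_of_nonneg_left h1 (by positivity)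
      refine (h6.trans h7).trans (le_of_eq ?_)
      ring
    · have : ({t} : Finset ℕ) ≠ Finset.range d := by
        intro h
        have := congrArg Finset.card h
        simp at this
        omega
      rw [h, if_neg this, pow_zero, mul_one]
      simp only [Finset.sum_singleton]
      rw [(hτ t).sum_comp (fun v => (f v - μ) ^ 2), ← h5]
      exact h1

theorem sum_range_mul {M : Type} [AddCommMonoid M] (d K : ℕ) (F : ℕ → M) :
    ∑ ρ ∈ Finset.range (d * K), F ρ =
      ∑ t ∈ Finset.range d, ∑ ρ ∈ Finset.range K, F (t + d * ρ) := by
  rw [Finset.sum_comm]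
  induction K with
  | zero => simp
  | succ K ih =>
    rw [Nat.mul_succ, Finset.sum_range_add, ih, Finset.sum_range_succ]
    simp only [add_comm]

/-- The least significant digit of the random number is the first label; splitting it off matches
one step of `walkSum`. The quotient left after `s` digits is the number `b` used in the blow-up. -/
theorem sum_walkBack_eq_walkSum {V : Type} {d : ℕ} (hd : 0 < d) (τ : ℕ → V → V) (M : ℕ)
    (h : V → ℕ → ℝ) (s : ℕ) (a : ℕ → Finset ℕ) (ha : ∀ i < s, a i ⊆ Finset.range d) (v : V) :
    (∑ ρ ∈ Finset.range (d ^ s * M), if ∀ i < s, ρ / d ^ i % d ∈ a i then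
      h (walkBack d τ s v ρ) (ρ / d ^ s) else 0) =
    walkSum τ s a (fun u => ∑ b ∈ Finset.range M, h u b) v := by
  induction s generalizing a v with
  | zero => simp [walkSum, walkBack]
  | succ s ih =>
    rw [walkSum, pow_succ', mul_assoc, sum_range_mul, ← Finset.sum_subset (ha 0 (by omega))]
    · refine Finset.sum_congr rfl fun t ht => ?_
      have htd := Finset.mem_range.1 (ha 0 (by omega) ht)
      rw [← ih (fun i => a (i + 1)) fun i hi => ha (i + 1) (by omega)]
      refine Finset.sum_congr rfl fun ρ _ => ?_
      have h1 : (t + d * ρ) / d = ρ := by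
        rw [Nat.add_mul_div_left _ _ hd, Nat.div_eq_of_lt htd, zero_add]
      have h2 : (t + d * ρ) % d = t := by simp [Nat.mod_eq_of_lt htd]
      have h3 : ∀ i, (t + d * ρ) / d ^ (i + 1) = ρ / d ^ i := by
        intro i
        rw [pow_succ', ← Nat.div_div_eq_div_mul, h1]
      have h4 : (∀ i < s + 1, (t + d * ρ) / d ^ i % d ∈ a i) ↔
          ∀ i < s, ρ / d ^ i % d ∈ a (i + 1) := by
        rw [Nat.forall_lt_succ_left]
        simp only [h3, pow_zero, Nat.div_one, h2, ht, true_and]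
      simp only [h4, ← pow_succ', h3, walkBack, h1, h2]
    · intro t htd ht
      refine Finset.sum_eq_zero fun ρ _ => if_neg fun hall => ht ?_
      have := hall 0 (by omega)
      simpa [Nat.mod_eq_of_lt (Finset.mem_range.1 htd)] using this

/-! ### Counting the random numbers consistent with an observation -/

/-- The word with code `y` has the digits `w` at the positions in `T`. -/
def Agrees (d : ℕ) (T : Finset ℕ) (w : ℕ → ℕ) (y : ℕ) : Prop := ∀ i ∈ T, y / d ^ i % d = w i

instance (d : ℕ) (T : Finset ℕ) (w : ℕ → ℕ) : DecidablePred (Agrees d T w) := fun y =>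
  inferInstanceAs (Decidable (∀ i ∈ T, y / d ^ i % d = w i))

/-- The labels allowed in the `j`-th step of the encoder by an observation `w` on `T`. -/
def allowedLabels (d e s : ℕ) (T : Finset ℕ) (w : ℕ → ℕ) (j : ℕ) : Finset ℕ :=
  if e + (s - 1 - j) ∈ T then {w (e + (s - 1 - j))} else Finset.range d

/-- The vertex part and the labels occupy disjoint blocks of digits. By the reversal in
`pushDigits`, the label of step `j` sits at position `e + (s - 1 - j)`. -/
theorem agrees_add_iff {d e s : ℕ} (hd : 0 < d) {T : Finset ℕ} {w : ℕ → ℕ}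
    (hT : T ⊆ Finset.range (e + s)) {y : ℕ} (hy : y < d ^ e) (z : ℕ) :
    Agrees d T w (y + d ^ e * pushDigits d s z 0) ↔
      Agrees d (T.filter (· < e)) w y ∧ ∀ j < s, z / d ^ j % d ∈ allowedLabels d e s T w j := by
  have hlow : ∀ i < e, (y + d ^ e * pushDigits d s z 0) / d ^ i % d = y / d ^ i % d := by
    intro i hi
    have : d ^ e * pushDigits d s z 0 = d ^ i * (d * (d ^ (e - i - 1) * pushDigits d s z 0)) := by
      rw [← mul_assoc d, ← pow_succ', ← mul_assoc, ← pow_add]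
      congr 2
      omega
    rw [this, Nat.add_mul_div_left _ _ (Nat.pow_pos hd), Nat.add_mul_mod_self_left]
  have hhigh : ∀ j < s, (y + d ^ e * pushDigits d s z 0) / d ^ (e + (s - 1 - j)) % d =
      z / d ^ j % d := by
    intro j hj
    rw [pow_add, ← Nat.div_div_eq_div_mul, Nat.add_mul_div_left _ _ (Nat.pow_pos hd),
      Nat.div_eq_of_lt hy, zero_add, pushDigits_digit hd _ _ _ _ (by omega)]
    congr 3
    omega
  constructor
  · intro h
    refine ⟨fun i hi => ?_, fun j hj => ?_⟩
    · obtain ⟨h1, h2⟩ := Finset.mem_filter.1 hi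
      rw [← hlow i h2]
      exact h i h1
    · unfold allowedLabels
      split_ifs with h1
      · rw [Finset.mem_singleton, ← hhigh j hj]
        exact h _ h1
      · exact Finset.mem_range.2 (Nat.mod_lt _ hd)
  · rintro ⟨h1, h2⟩ i hi
    rcases lt_or_ge i e with h | h
    · rw [hlow i h]
      exact h1 i (Finset.mem_filter.2 ⟨hi, h⟩)
    · have h3 := Finset.mem_range.1 (hT hi)
      have e1 : e + (s - 1 - (s - 1 - (i - e))) = i := by omega
      have h4 := h2 (s - 1 - (i - e)) (by omega)
      rw [allowedLabels, e1, if_pos hi, Finset.mem_singleton] at h4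
      rw [← h4, ← hhigh _ (by omega), e1]

theorem allowedLabels_eq_range_iff {d e s : ℕ} (hd : 2 ≤ d) {T : Finset ℕ} {w : ℕ → ℕ} (j : ℕ) :
    allowedLabels d e s T w j = Finset.range d ↔ e + (s - 1 - j) ∉ T := by
  unfold allowedLabels
  split_ifs with h
  · simp only [h, not_true_eq_false, iff_false]
    intro h
    have := congrArg Finset.card h
    simp at this
    omega
  · simp [h]

theorem allowedLabels_eq {d e s : ℕ} {T : Finset ℕ} {w : ℕ → ℕ} (j : ℕ) :
    allowedLabels d e s T w j = Finset.range d ∨ ∃ t, allowedLabels d e s T w j = {t} := by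
  unfold allowedLabels
  split_ifs
  · exact Or.inr ⟨_, rfl⟩
  · exact Or.inl rfl

theorem allowedLabels_subset {d e s : ℕ} {T : Finset ℕ} {w : ℕ → ℕ} (hw : ∀ i, w i < d) (j : ℕ) :
    allowedLabels d e s T w j ⊆ Finset.range d := by
  unfold allowedLabels
  split_ifs
  · simpa using hw _
  · rfl

theorem sum_range_mem_eq_card {T : Finset ℕ} {n : ℕ} :
    (∑ i ∈ Finset.range n, if i ∈ T then 1 else 0) = (T.filter (· < n)).card := by
  rw [← Finset.sum_filter, Finset.sum_const, smul_eq_mul, mul_one]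
  congr 1
  ext i
  simp [and_comm]

/-- Each observed position beyond the vertex part fixes exactly one label. The additive form avoids
truncated subtraction. -/
theorem freeSteps_add_card {d e s : ℕ} (hd : 2 ≤ d) {T : Finset ℕ} {w : ℕ → ℕ}
    (hT : T ⊆ Finset.range (e + s)) :
    (∑ j ∈ Finset.range s, if allowedLabels d e s T w j = Finset.range d then 1 else 0) + T.card =
      s + (T.filter (· < e)).card := by
  have h1 : ∀ j, (if allowedLabels d e s T w j = Finset.range d then 1 else 0) =
      if e + (s - 1 - j) ∈ T then 0 else 1 := by
    intro j
    simp only [allowedLabels_eq_range_iff hd]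
    split_ifs <;> simp_all
  rw [Finset.sum_congr rfl fun j _ => h1 j,
    Finset.sum_range_reflect (fun j => if e + j ∈ T then 0 else 1) s]
  have h2 : T.card = ∑ i ∈ Finset.range (e + s), if i ∈ T then 1 else 0 := by
    rw [sum_range_mem_eq_card, Finset.filter_true_of_mem fun i hi => Finset.mem_range.1 (hT hi)]
  rw [h2, Finset.sum_range_add, sum_range_mem_eq_card, add_left_comm, ← Finset.sum_add_distrib,
    add_comm]
  congr 1
  have h3 : ∀ j, (if e + j ∈ T then 0 else 1) + (if e + j ∈ T then 1 else 0) = 1 := by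
    intro j
    split_ifs <;> rfl
  simp [h3]

theorem card_agrees {d e : ℕ} (hd : 2 ≤ d) {T : Finset ℕ} {w : ℕ → ℕ} (hw : ∀ i, w i < d)
    (hT : T ⊆ Finset.range e) :
    (∑ y ∈ Finset.range (d ^ e), if Agrees d T w y then (1 : ℝ) else 0) * d ^ T.card = d ^ e := by
  set a : ℕ → Finset ℕ := fun i => if i ∈ T then {w i} else Finset.range d with ha
  have hsub : ∀ i, a i ⊆ Finset.range d := by
    intro i
    simp only [ha]
    split_ifs
    · simpa using hw i
    · rfl
  have hsing : ∀ i, a i = Finset.range d ∨ ∃ t, a i = {t} := by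
    intro i
    simp only [ha]
    split_ifs
    · exact Or.inr ⟨_, rfl⟩
    · exact Or.inl rfl
  have hrange : ∀ i, a i = Finset.range d ↔ i ∉ T := by
    intro i
    simp only [ha]
    split_ifs with h
    · simp only [h, not_true_eq_false, iff_false]
      intro h
      have := congrArg Finset.card h
      simp at this
      omega
    · simp [h]
  -- Counting words with prescribed digits is the case of restricted walks on a single vertex.
  have h1 := sum_walkBack_eq_walkSum (V := Unit) (by omega : 0 < d) (fun _ v => v) 1
    (fun _ _ => 1) e a (fun i _ => hsub i) ()
  have h2 := walkSum_sum (V := Unit) hd (τ := fun _ v => v) (fun _ => Function.bijective_id)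
    (fun u => ∑ b ∈ Finset.range 1, (1 : ℝ)) e a (fun i _ => hsing i)
  simp only [Finset.univ_unique, Finset.sum_singleton, Finset.range_one, mul_one] at h1 h2
  have h3 : ∀ y ∈ Finset.range (d ^ e), (if Agrees d T w y then (1 : ℝ) else 0) =
      if ∀ i < e, y / d ^ i % d ∈ a i then 1 else 0 := by
    intro y _
    congr 1
    refine propext ⟨fun h i _ => ?_, fun h i hi => ?_⟩
    · simp only [ha]
      split_ifs with hi
      · simpa using h i hi
      · exact Finset.mem_range.2 (Nat.mod_lt _ (by omega))
    · have := h i (Finset.mem_range.1 (hT hi))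
      simpa [ha, hi] using this
  rw [Finset.sum_congr rfl h3, h1]
  have h4 : walkSum (V := Unit) (fun _ v => v) e a (fun _ => 1) () = _ := h2
  rw [h4, ← pow_add]
  congr 1
  have h5 : T.card = ∑ i ∈ Finset.range e, if i ∈ T then 1 else 0 := by
    rw [sum_range_mem_eq_card, Finset.filter_true_of_mem fun i hi => Finset.mem_range.1 (hT hi)]
  rw [h5, ← Finset.sum_add_distrib]
  have h6 : ∀ i, (if a i = Finset.range d then 1 else 0) + (if i ∈ T then 1 else 0) = 1 := by
    intro i
    simp only [hrange]
    split_ifs <;> simp_all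
  simp [h6]

/-- Every `y` below `d ^ (m + k)` is the blow-up of the pair `(y % N, y / N)`, and `y / N < d ^ k`
because `d ^ m ≤ N`. The pairs that fall back to `u` only add nonnegative terms. -/
theorem sum_le_sum_blowUp {d N m k : ℕ} (hd : 0 < d) (hN : d ^ m ≤ N) (F : ℕ → ℝ)
    (hF : ∀ y, 0 ≤ F y) :
    ∑ y ∈ Finset.range (d ^ (m + k)), F y ≤
      ∑ u : Fin N, ∑ b ∈ Finset.range (d ^ k), F (blowUp N (d ^ (m + k)) u b) := by
  have hN0 : 0 < N := (Nat.pow_pos hd).trans_le hN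
  rw [← Finset.sum_range (fun u => ∑ b ∈ Finset.range (d ^ k), F (blowUp N (d ^ (m + k)) u b)),
    ← Finset.sum_product']
  set φ : ℕ → ℕ × ℕ := fun y => (y % N, y / N) with hφ
  have hφinj : Function.Injective φ := by
    intro y y' h
    simp only [hφ, Prod.mk.injEq] at h
    rw [← Nat.mod_add_div y N, ← Nat.mod_add_div y' N, h.1, h.2]
  have h1 : ∑ y ∈ Finset.range (d ^ (m + k)), F y =
      ∑ x ∈ (Finset.range (d ^ (m + k))).image φ, F (blowUp N (d ^ (m + k)) x.1 x.2) := by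
    rw [Finset.sum_image hφinj.injOn]
    refine Finset.sum_congr rfl fun y hy => ?_
    rw [blowUp, if_pos] <;> simp only [hφ, Nat.mod_add_div]
    exact Finset.mem_range.1 hy
  rw [h1]
  refine Finset.sum_le_sum_of_subset_of_nonneg ?_ fun _ _ _ => hF _
  intro x hx
  obtain ⟨y, hy, rfl⟩ := Finset.mem_image.1 hx
  simp only [Finset.mem_product, Finset.mem_range, hφ] at hy ⊢
  refine ⟨Nat.mod_lt _ hN0, Nat.div_lt_of_lt_mul (hy.trans_le ?_)⟩
  rw [pow_add]
  exact Nat.mul_le_mul_right _ hN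

theorem walkBack_coe {d N : ℕ} {τF : ℕ → Fin N → Fin N} {τ : ℕ → ℕ → ℕ}
    (hτ : ∀ t (v : Fin N), τ t v = τF t v) (s : ℕ) (v : Fin N) (z : ℕ) :
    ((walkBack d τF s v z : Fin N) : ℕ) = walkBack d τ s v z := by
  induction s generalizing v z with
  | zero => rfl
  | succ s ih => rw [walkBack, walkBack, ih, hτ]

/-- The number of random numbers below `R` for which the codeword of `v` agrees with the observation
`w` on `T`. -/
def agreeCount (d N m k s : ℕ) (τ : ℕ → ℕ → ℕ) (T : Finset ℕ) (w : ℕ → ℕ) (R v : ℕ) : ℝ :=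
  ∑ z ∈ Finset.range R, if Agrees d T w (encNat d N m k s τ v z) then 1 else 0

/-- Over a full period of random numbers the counts are a `walkSum` of `g`, where `g u` is the
number of blow-ups of `u` matching the observed vertex digits. From `0 ≤ g ≤ d ^ k` the deviation of
`g` is at most `d ^ k * G`, with `G` the total of `g`. The free labels contract it, Cauchy–Schwarz
passes to `L¹`, and `G ≥ d ^ (m + k - a)` makes the estimate relative to the mean `A`. -/
theorem sum_abs_agreeCount_sub_le {d N m k s : ℕ} (hd : 2 ≤ d) (hN : d ^ m ≤ N)
    (hN' : N ≤ d ^ (m + k)) {τF : ℕ → Fin N → Fin N} {τ : ℕ → ℕ → ℕ}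
    (hτ : ∀ t (v : Fin N), τ t v = τF t v) (hbij : ∀ t, Function.Bijective (τF t)) {θ : ℝ}
    (hθ : 0 ≤ θ)
    (hcontr : ∀ g : Fin N → ℝ, ∑ v, g v = 0 →
      ∑ v, (∑ t ∈ Finset.range d, g (τF t v)) ^ 2 ≤ d ^ 2 * θ * ∑ v, g v ^ 2)
    {T : Finset ℕ} {w : ℕ → ℕ} (hw : ∀ i, w i < d) (hT : T ⊆ Finset.range (m + k + s))
    {f a : ℕ} (ha : a = (T.filter (· < m + k)).card) (hf : f + T.card = s + a) :
    ∃ A : ℝ, 0 < A ∧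
      ∑ v : Fin N, agreeCount d N m k s τ T w (d ^ s * d ^ k) v = N * A ∧
      ∑ v : Fin N, |agreeCount d N m k s τ T w (d ^ s * d ^ k) v - A| ≤
        √(d ^ (3 * k + a) * θ ^ f) * (A * d ^ m) := by
  have hd0 : 0 < d := by omega
  have hdR : (0 : ℝ) < d := by exact_mod_cast hd0
  have hN0 : 0 < N := (Nat.pow_pos hd0).trans_le hN
  have hNR : (0 : ℝ) < N := by exact_mod_cast hN0
  have : Nonempty (Fin N) := ⟨⟨0, hN0⟩⟩
  set T' := T.filter (· < m + k) with hT'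
  set al := allowedLabels d (m + k) s T w with hal
  set g : Fin N → ℝ := fun u => ∑ b ∈ Finset.range (d ^ k),
    if Agrees d T' w (blowUp N (d ^ (m + k)) u b) then 1 else 0 with hg
  have hc : ∀ v : Fin N, agreeCount d N m k s τ T w (d ^ s * d ^ k) v = walkSum τF s al g v := by
    intro v
    have h1 := sum_walkBack_eq_walkSum hd0 τF (d ^ k)
      (fun u b => if Agrees d T' w (blowUp N (d ^ (m + k)) u b) then 1 else 0) s al
      (fun i _ => allowedLabels_subset hw i) v
    rw [hg, ← h1]
    refine Finset.sum_congr rfl fun z hz => ?_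
    have h2 : z / d ^ s < d ^ k := Nat.div_lt_of_lt_mul (Finset.mem_range.1 hz)
    have h3 := blowUp_lt (N := N) (b := z / d ^ s)
      ((walkBack d τF s v z).2.trans_le hN')
    rw [encNat, Nat.mod_eq_of_lt h2, ← walkBack_coe hτ, ← ite_and]
    simp only [agrees_add_iff hd0 hT h3 z]
    congr 1
    exact propext and_comm
  have hfeq : (∑ i ∈ Finset.range s, if al i = Finset.range d then 1 else 0) = f := by
    have := freeSteps_add_card hd (w := w) hT
    rw [← hal, ← hT', ← ha] at this
    omega
  have hsum := walkSum_sum hd hbij g s al (fun i _ => allowedLabels_eq i)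
  have hdev := walkSum_deviation_le hd hbij hθ hcontr g s al (fun i _ => allowedLabels_eq i)
  rw [hfeq] at hsum hdev
  set G := ∑ u, g u with hG
  have hGlow : (d : ℝ) ^ (m + k) ≤ G * d ^ a := by
    have h1 := card_agrees hd hw (fun i hi => Finset.mem_range.2 (Finset.mem_filter.1 hi).2 :
      T' ⊆ Finset.range (m + k))
    rw [← ha] at h1
    rw [← h1]
    refine mul_le_mul_of_nonneg_right ?_ (by positivity)
    exact sum_le_sum_blowUp hd0 hN (fun y => if Agrees d T' w y then (1 : ℝ) else 0)
      (fun y => by positivity)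
  have hG0 : 0 < G := by
    have : 0 < G * (d : ℝ) ^ a := lt_of_lt_of_le (by positivity) hGlow
    exact (mul_pos_iff_of_pos_right (by positivity)).1 this
  have hg0 : ∀ u, 0 ≤ g u := fun u => Finset.sum_nonneg fun _ _ => by positivity
  have hgle : ∀ u, g u ≤ d ^ k := by
    intro u
    calc g u ≤ ∑ b ∈ Finset.range (d ^ k), (1 : ℝ) :=
          Finset.sum_le_sum fun _ _ => by split_ifs <;> norm_num
      _ = d ^ k := by simp
  have hdevg : deviation g ≤ d ^ k * G := by
    refine (deviation_le g).trans ?_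
    rw [hG, Finset.mul_sum]
    refine Finset.sum_le_sum fun u _ => ?_
    rw [sq]
    exact mul_le_mul_of_nonneg_right (hgle u) (hg0 u)
  refine ⟨d ^ f * G / N, by positivity, ?_, ?_⟩
  · rw [Finset.sum_congr rfl fun v _ => hc v, hsum]
    field_simp
  · rw [Finset.sum_congr rfl fun v _ => by rw [hc v]]
    refine abs_le_of_sq_le_sq' ?_ (by positivity) |>.2
    have hCS := sq_sum_le_card_mul_sum_sq (s := (Finset.univ : Finset (Fin N)))
      (f := fun v => |walkSum τF s al g v - d ^ f * G / N|)
    have hdev' : ∑ v, |walkSum τF s al g v - d ^ f * G / N| ^ 2 =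
        deviation (walkSum τF s al g) := by
      unfold deviation
      rw [hsum, Fintype.card_fin]
      simp only [sq_abs]
    rw [hdev', Finset.card_univ, Fintype.card_fin] at hCS
    have h1 : deviation (walkSum τF s al g) ≤ (d ^ 2 * θ) ^ f * (d ^ k * G) :=
      hdev.trans (mul_le_mul_of_nonneg_left hdevg (by positivity))
    refine hCS.trans ((mul_le_mul_of_nonneg_left h1 hNR.le).trans ?_)
    rw [mul_pow (√((d : ℝ) ^ (3 * k + a) * θ ^ f)), Real.sq_sqrt (by positivity)]
    have hNle : (N : ℝ) ≤ d ^ (m + k) := by exact_mod_cast hN'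
    -- Here the `3 * k` arises: bounding `N ^ 3` by `d ^ (3 * (m + k))` gives, with the factor `d ^
    -- k`, the exponent `3 * m + 4 * k`, and the lower bound on `G` absorbs `m + k` of it at the
    -- price of `a`.
    have h2 : (N : ℝ) ^ 3 * d ^ k ≤ d ^ (3 * k + a) * d ^ (2 * m) * G := by
      calc (N : ℝ) ^ 3 * d ^ k ≤ ((d : ℝ) ^ (m + k)) ^ 3 * (d : ℝ) ^ k := by gcongr
        _ = (d : ℝ) ^ (3 * k) * (d : ℝ) ^ (2 * m) * (d : ℝ) ^ (m + k) := by ring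
        _ ≤ (d : ℝ) ^ (3 * k) * (d : ℝ) ^ (2 * m) * (G * d ^ a) := by gcongr
        _ = _ := by ring
    have h3 : (N : ℝ) * ((d ^ 2 * θ) ^ f * (d ^ k * G)) =
        (N ^ 3 * d ^ k) * (d ^ (2 * f) * θ ^ f * G / N ^ 2) := by
      field_simp
      ring
    rw [h3]
    calc _ ≤ (d ^ (3 * k + a) * d ^ (2 * m) * G) * (d ^ (2 * f) * θ ^ f * G / N ^ 2) := by gcongr
      _ = _ := by
        field_simp
        ring

/-! ### Periodicity in the random number: replacing a full period by an arbitrary range -/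

theorem walkBack_add {V : Type} {d : ℕ} (hd : 0 < d) (τ : ℕ → V → V) (s : ℕ) (v : V) (z e : ℕ) :
    walkBack d τ s v (z + d ^ s * e) = walkBack d τ s v z := by
  induction s generalizing v z with
  | zero => rfl
  | succ s ih =>
    rw [walkBack, walkBack, pow_succ', mul_assoc, Nat.add_mul_mod_self_left,
      Nat.add_mul_div_left _ _ hd, ih]

theorem pushDigits_add {d : ℕ} (hd : 0 < d) (s z acc e : ℕ) :
    pushDigits d s (z + d ^ s * e) acc = pushDigits d s z acc := by
  induction s generalizing z acc with
  | zero => rfl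
  | succ s ih =>
    rw [pushDigits, pushDigits, pow_succ', mul_assoc, Nat.add_mul_mod_self_left,
      Nat.add_mul_div_left _ _ hd, ih]

theorem encNat_add {d N m k s : ℕ} (hd : 0 < d) (τ : ℕ → ℕ → ℕ) (x z e : ℕ) :
    encNat d N m k s τ x (z + d ^ s * d ^ k * e) = encNat d N m k s τ x z := by
  rw [encNat, encNat, mul_assoc, walkBack_add hd, pushDigits_add hd,
    Nat.add_mul_div_left _ _ (Nat.pow_pos hd), Nat.add_mul_mod_self_left]

/-- `R` lies between consecutive multiples of `P`, so both quantities lie between the same two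
consecutive multiples of the sum over one period. -/
theorem abs_sum_periodic_sub_le {F : ℕ → ℝ} (hF : ∀ z, 0 ≤ F z) {P : ℕ} (hP : 0 < P)
    (hper : ∀ z e, F (z + P * e) = F z) (R : ℕ) :
    |∑ z ∈ Finset.range R, F z - R / P * ∑ z ∈ Finset.range P, F z| ≤
      ∑ z ∈ Finset.range P, F z := by
  set c := ∑ z ∈ Finset.range P, F z with hc
  have hPR : (0 : ℝ) < P := by exact_mod_cast hP
  have hc0 : 0 ≤ c := Finset.sum_nonneg fun z _ => hF z
  have h1 : ∀ e : ℕ, ∑ z ∈ Finset.range (P * e), F z = e * c := by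
    intro e
    induction e with
    | zero => simp
    | succ e ih =>
      rw [Nat.mul_succ, Finset.sum_range_add, ih]
      simp only [add_comm (P * e), hper]
      push_cast
      ring
  set e := R / P with he
  have hle : P * e ≤ R := Nat.mul_div_le R P
  have hlt : R < P * (e + 1) := Nat.lt_mul_div_succ R hP
  have h2 : (e : ℝ) * c ≤ ∑ z ∈ Finset.range R, F z := by
    rw [← h1]
    exact Finset.sum_le_sum_of_subset_of_nonneg (Finset.range_mono hle) fun z _ _ => hF z
  have h3 : ∑ z ∈ Finset.range R, F z ≤ ((e + 1 : ℕ) : ℝ) * c := by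
    rw [← h1]
    exact Finset.sum_le_sum_of_subset_of_nonneg (Finset.range_mono hlt.le) fun z _ _ => hF z
  have h4 : (e : ℝ) ≤ R / P := by
    rw [le_div_iff₀ hPR, mul_comm]
    exact_mod_cast hle
  have h5 : (R : ℝ) / P ≤ e + 1 := by
    rw [div_le_iff₀ hPR, mul_comm]
    exact_mod_cast hlt.le
  have h6 := mul_le_mul_of_nonneg_right h4 hc0
  have h7 := mul_le_mul_of_nonneg_right h5 hc0
  push_cast at h3
  rw [abs_le]
  constructor <;> linarith

/-- Truncation costs each vertex at most its count over one period, hence `N * A ≤ d ^ (m + k) * A`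
in total. Relative to the new mean `R / P * A` with `P = d ^ (s + k)`, this is the term `d ^ (s + 2
* k) / R`. -/
theorem sum_abs_agreeCount_sub_le_of_range {d N m k s R : ℕ} (hd : 0 < d) (hR : 0 < R)
    (hN' : N ≤ d ^ (m + k)) {τ : ℕ → ℕ → ℕ} {T : Finset ℕ} {w : ℕ → ℕ} {A η : ℝ} (hA : 0 < A)
    (hsum : ∑ v : Fin N, agreeCount d N m k s τ T w (d ^ s * d ^ k) v = N * A)
    (hη : ∑ v : Fin N, |agreeCount d N m k s τ T w (d ^ s * d ^ k) v - A| ≤ η * (A * d ^ m)) :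
    ∃ A' : ℝ, 0 < A' ∧ ∑ v : Fin N, |agreeCount d N m k s τ T w R v - A'| ≤
      (η + d ^ (s + 2 * k) / R) * (A' * d ^ m) := by
  have hdR : (0 : ℝ) < d := by exact_mod_cast hd
  have hRR : (0 : ℝ) < R := by exact_mod_cast hR
  have hNle : (N : ℝ) ≤ d ^ (m + k) := by exact_mod_cast hN'
  set P := d ^ s * d ^ k with hP
  have hP0 : 0 < P := by positivity
  have hPR : (P : ℝ) = d ^ s * d ^ k := by
    rw [hP]
    push_cast
    rfl
  have hPpos : (0 : ℝ) < P := by exact_mod_cast hP0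
  refine ⟨R / P * A, by positivity, ?_⟩
  have h1 : ∀ v : Fin N, |agreeCount d N m k s τ T w R v - R / P * A| ≤
      agreeCount d N m k s τ T w P v + R / P * |agreeCount d N m k s τ T w P v - A| := by
    intro v
    have h2 := abs_sum_periodic_sub_le
      (F := fun z => if Agrees d T w (encNat d N m k s τ v z) then (1 : ℝ) else 0)
      (fun z => by positivity) hP0 (fun z e => by simp only [hP, encNat_add hd]) R
    have h3 : |(R : ℝ) / P * (agreeCount d N m k s τ T w P v - A)| =
        R / P * |agreeCount d N m k s τ T w P v - A| := by
      rw [abs_mul, abs_of_nonneg (by positivity)]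
    rw [← h3]
    refine le_trans (le_of_eq ?_) ((abs_add_le _ _).trans (add_le_add_left h2 _))
    congr 1
    unfold agreeCount
    ring
  refine (Finset.sum_le_sum fun v _ => h1 v).trans ?_
  rw [Finset.sum_add_distrib, hsum, ← Finset.mul_sum]
  have h4 : (R : ℝ) / P * ∑ v : Fin N, |agreeCount d N m k s τ T w P v - A| ≤
      R / P * (η * (A * d ^ m)) := mul_le_mul_of_nonneg_left hη (by positivity)
  have h5 : (N : ℝ) * A ≤ d ^ (m + k) * A := mul_le_mul_of_nonneg_right hNle hA.le
  have h6 : (η + d ^ (s + 2 * k) / R) * (R / P * A * d ^ m) =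
      d ^ (m + k) * A + R / P * (η * (A * d ^ m)) := by
    rw [hPR]
    field_simp
    ring
  rw [h6]
  exact add_le_add h5 h4

/-! ### Words and their codes -/

/-- The word of length `k` formed by the lowest base-`q` digits of `c`. -/
def toWord (q k : ℕ) [NeZero q] (c : ℕ) : Fin k → Fin q := fun i => Fin.ofNat q (c / q ^ (i : ℕ))

theorem wordCode_eq {q k : ℕ} (w : Fin k → Fin q) : wordCode w = finFunctionFinEquiv w := by
  rw [finFunctionFinEquiv_apply]
  rfl

theorem wordCode_lt {q k : ℕ} (w : Fin k → Fin q) : wordCode w < q ^ k := by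
  rw [wordCode_eq]
  exact Fin.is_lt _

theorem wordCode_injective {q k : ℕ} :
    Function.Injective (wordCode : (Fin k → Fin q) → ℕ) := by
  intro w w' h
  rw [wordCode_eq, wordCode_eq] at h
  exact finFunctionFinEquiv.injective (Fin.ext h)

theorem toWord_eq {q k : ℕ} [NeZero q] {c : ℕ} (hc : c < q ^ k) :
    toWord q k c = finFunctionFinEquiv.symm ⟨c, hc⟩ := by
  funext i
  ext
  simp [toWord]

theorem wordCode_toWord {q k : ℕ} [NeZero q] {c : ℕ} (hc : c < q ^ k) :
    wordCode (toWord q k c) = c := by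
  rw [toWord_eq hc, wordCode_eq, Equiv.apply_symm_apply]

theorem sum_wordCode {q k : ℕ} (F : ℕ → ℝ) :
    ∑ w : Fin k → Fin q, F (wordCode w) = ∑ c ∈ Finset.range (q ^ k), F c := by
  rw [Finset.sum_range, ← finFunctionFinEquiv.sum_comp]
  exact Finset.sum_congr rfl fun w _ => by rw [wordCode_eq]

/-! ### Statistical distance -/

/-- The total of `c` differs from `A * Fintype.card X` by at most the fraction `η ≤ 1/2`, so
normalizing costs a second error of the same size and a factor of at most `2`; the `1/2` in
`statDist` leaves `2 * η`. -/
theorem statDist_uniform_le {X : Type} [Fintype X] [Nonempty X] (c : X → ℝ) {A η : ℝ} (hA : 0 < A)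
    (hη : η ≤ 1 / 2) (h : ∑ x, |c x - A| ≤ η * (A * Fintype.card X)) :
    statDist (fun x => c x / ∑ y, c y) (fun _ => 1 / (Fintype.card X : ℝ)) ≤ 2 * η := by
  have hM : (0 : ℝ) < Fintype.card X := by exact_mod_cast Fintype.card_pos
  set M : ℝ := (Fintype.card X : ℝ) with hMdef
  set C := ∑ y, c y with hC
  have hAM : 0 < A * M := mul_pos hA hM
  have h1 : |C - A * M| ≤ η * (A * M) := by
    refine le_trans (le_trans (le_of_eq ?_) (Finset.abs_sum_le_sum_abs _ _)) h
    rw [Finset.sum_sub_distrib]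
    simp [hC, hMdef, mul_comm]
  have hη0 : 0 ≤ η := by
    by_contra hneg
    have : η * (A * M) < 0 := mul_neg_of_neg_of_pos (not_le.1 hneg) hAM
    linarith [abs_nonneg (C - A * M)]
  have h2 : A * M / 2 ≤ C := by
    have := (abs_le.1 h1).1
    nlinarith
  have hC0 : 0 < C := by linarith
  have h3 : ∀ x, |c x / C - 1 / M| ≤ |c x - A| / C + |C - A * M| / (C * M) := by
    intro x
    have e : c x / C - 1 / M = (c x - A) / C + -((C - A * M) / (C * M)) := by
      field_simp
      ring
    rw [e]
    refine (abs_add_le _ _).trans ?_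
    rw [abs_neg, abs_div, abs_div, abs_of_pos hC0, abs_of_pos (mul_pos hC0 hM)]
  have h4 : ∑ x, |c x / C - 1 / M| ≤ η * (A * M) / C + η * (A * M) / C := by
    refine (Finset.sum_le_sum fun x _ => h3 x).trans ?_
    rw [Finset.sum_add_distrib, ← Finset.sum_div, Finset.sum_const, Finset.card_univ, nsmul_eq_mul,
      ← hMdef]
    have e : M * (|C - A * M| / (C * M)) = |C - A * M| / C := by field_simp
    rw [e]
    gcongr
  have h5 : η * (A * M) / C ≤ 2 * η := by
    rw [div_le_iff₀ hC0]
    nlinarith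
  unfold statDist
  linarith

theorem unifProb_eq {Ω : Type} [Fintype Ω] (A : Ω → Prop) [DecidablePred A] :
    unifProb A = (∑ ω, if A ω then (1 : ℝ) else 0) / Fintype.card Ω := by
  unfold unifProb
  rw [Nat.card_eq_fintype_card, Fintype.card_subtype, Finset.sum_boole]

theorem posterior_eq {d m n r : ℕ} (E : (Fin m → Fin d) → (Fin r → Fin 2) → (Fin n → Fin d))
    (S : Finset (Fin n)) (w : S → Fin d) (x : Fin m → Fin d) :
    posterior E S w x = (∑ z, if (fun i : S => E x z i) = w then (1 : ℝ) else 0) /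
      ∑ y, ∑ z, if (fun i : S => E y z i) = w then (1 : ℝ) else 0 := by
  have hne : Nonempty ((Fin m → Fin d) × (Fin r → Fin 2)) := ⟨x, fun _ => 0⟩
  have hcard : ((Fintype.card ((Fin m → Fin d) × (Fin r → Fin 2)) : ℕ) : ℝ) ≠ 0 := by
    exact_mod_cast Fintype.card_ne_zero
  unfold posterior
  rw [unifProb_eq, unifProb_eq, div_div_div_cancel_right₀ hcard, Fintype.sum_prod_type,
    Fintype.sum_prod_type]
  congr 1
  rw [Finset.sum_eq_single x]
  · simp
  · intro y _ hy
    simp [hy]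
  · simp

theorem unifProb_le_zero {Ω : Type} [Fintype Ω] {A : Ω → Prop} (h : ∀ ω, ¬ A ω) :
    unifProb A ≤ 0 := by
  have : IsEmpty {ω // A ω} := ⟨fun ω => h ω.1 ω.2⟩
  simp [unifProb]

/-! ### The protocol of a graph -/

section GraphProtocol

variable {d : ℕ} [NeZero d]

/-- The labeling of a graph, on natural numbers. -/
def stepNat {N : ℕ} (L : Fin N → Fin d → Fin N) (u t : ℕ) : ℕ :=
  if h : u < N then L ⟨u, h⟩ (Fin.ofNat d t) else 0

/-- The inverse steps, on natural numbers. -/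
noncomputable def stepBackNat {N : ℕ} (L : Fin N → Fin d → Fin N) (t v : ℕ) : ℕ :=
  if h : v < N then RegularGraph.stepBack L t ⟨v, h⟩ else 0

theorem stepBackNat_coe {N : ℕ} (L : Fin N → Fin d → Fin N) (t : ℕ) (v : Fin N) :
    stepBackNat L t v = RegularGraph.stepBack L t v := by
  simp [stepBackNat]

theorem stepNat_coe {N : ℕ} (L : Fin N → Fin d → Fin N) (u : Fin N) (t : ℕ) :
    stepNat L u t = L u (Fin.ofNat d t) := by
  simp [stepNat]

theorem stepNat_lt {N : ℕ} (L : Fin N → Fin d → Fin N) {u : ℕ} (hu : u < N) (t : ℕ) :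
    stepNat L u t < N := by
  rw [stepNat, dif_pos hu]
  exact Fin.is_lt _

theorem stepBackNat_lt {N : ℕ} (L : Fin N → Fin d → Fin N) (t : ℕ) {v : ℕ} (hv : v < N) :
    stepBackNat L t v < N := by
  rw [stepBackNat, dif_pos hv]
  exact Fin.is_lt _

namespace RegularGraph.IsConsistentLabeling

variable {N : ℕ} {G : RegularGraph d N} {L : Fin N → Fin d → Fin N}

theorem stepNat_stepBackNat (hL : G.IsConsistentLabeling L) (t : ℕ) {v : ℕ} (hv : v < N) :
    stepNat L (stepBackNat L t v) t = v := by
  have := hL.apply_stepBack t ⟨v, hv⟩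
  rw [stepBackNat, dif_pos hv, stepNat_coe, this]

theorem stepBackNat_stepNat (hL : G.IsConsistentLabeling L) (t : ℕ) {u : ℕ} (hu : u < N) :
    stepBackNat L t (stepNat L u t) = u := by
  have := hL.stepBack_apply t ⟨u, hu⟩
  rw [stepNat, dif_pos hu, stepBackNat_coe, this]

theorem exists_stepNat_stepNat (hL : G.IsConsistentLabeling L) (t : ℕ) {v : ℕ} (hv : v < N) :
    ∃ j < d, stepNat L (stepNat L v j) t = v := by
  obtain ⟨j, hj⟩ := hL.exists_neighbor t ⟨v, hv⟩
  refine ⟨j, j.2, ?_⟩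
  have h1 : stepNat L v j = stepBack L t ⟨v, hv⟩ := by
    rw [← hj, stepNat, dif_pos hv]
    simp
  rw [h1, stepNat_coe, hL.apply_stepBack]

end RegularGraph.IsConsistentLabeling

/-- The encoder of the protocol. -/
noncomputable def graphEncoder {N : ℕ} (L : Fin N → Fin d → Fin N) (m k s n r : ℕ)
    (x : Fin m → Fin d) (z : Fin r → Fin 2) : Fin n → Fin d :=
  toWord d n (encNat d N m k s (stepBackNat L) (wordCode x) (wordCode z))

/-- The decoder of the protocol. -/
def graphDecoder {N : ℕ} (L : Fin N → Fin d → Fin N) (m k s n : ℕ)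
    (y : Fin n → Fin d) : Fin m → Fin d :=
  toWord d m (decNat d N m k s (stepNat L) (wordCode y))

variable {N m k s n r : ℕ} {G : RegularGraph d N} {L : Fin N → Fin d → Fin N}

theorem wordCode_graphEncoder (hn : n = m + k + s) (hN : d ^ m ≤ N) (hN' : N ≤ d ^ (m + k))
    (x : Fin m → Fin d) (z : Fin r → Fin 2) :
    wordCode (graphEncoder L m k s n r x z) =
      encNat d N m k s (stepBackNat L) (wordCode x) (wordCode z) := by
  subst hn
  exact wordCode_toWord (encNat_lt (NeZero.pos d) (fun t _ v hv => stepBackNat_lt L t hv) hN'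
    ((wordCode_lt x).trans_le hN) _)

theorem wordCode_graphDecoder (y : Fin n → Fin d) :
    wordCode (graphDecoder L m k s n y) = decNat d N m k s (stepNat L) (wordCode y) :=
  wordCode_toWord (Nat.mod_lt _ (Nat.pow_pos (NeZero.pos d)))

theorem graphDecoder_graphEncoder (hL : G.IsConsistentLabeling L) (hn : n = m + k + s)
    (hN : d ^ m ≤ N) (hN' : N ≤ d ^ (m + k)) (x : Fin m → Fin d) (z : Fin r → Fin 2) :
    graphDecoder L m k s n (graphEncoder L m k s n r x z) = x := by
  apply wordCode_injective
  rw [wordCode_graphDecoder, wordCode_graphEncoder hn hN hN']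
  exact decNat_encNat (NeZero.pos d)
    (fun t _ v hv => ⟨stepBackNat_lt L t hv, hL.stepNat_stepBackNat t hv⟩) hN'
    ((wordCode_lt x).trans_le hN) (wordCode_lt x) _

/-- The bound on the counts is uniform in the observed word, so no observation is bad. By uniformity
of the message, the posterior is proportional to the counts. -/
theorem isResilientWiretap_graph (hd : 2 ≤ d) {lam : ℝ} (hlam : lam < 1)
    (hgap : 1 - lam ≤ G.spectralGap) (hL : G.IsConsistentLabeling L) (hn : n = m + k + s)
    (hN : d ^ m ≤ N) (hN' : N ≤ d ^ (m + k)) {t ε : ℝ} (hε : ε ≤ 1)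
    (hbound : ∀ t' a f : ℕ, (t' : ℝ) ≤ t → a ≤ t' → a ≤ m + k → f + t' = s + a →
      √(d ^ (3 * k + a) * (lam ^ 2) ^ f) + d ^ (s + 2 * k) / 2 ^ r ≤ ε / 2) :
    IsResilientWiretap (graphEncoder L m k s n r) (graphDecoder L m k s n) t ε 0 := by
  have hd0 : 0 < d := NeZero.pos d
  have hdR : (d : ℝ) ≠ 0 := by exact_mod_cast hd0.ne'
  refine ⟨graphDecoder_graphEncoder hL hn hN hN', fun S hS => unifProb_le_zero fun ω hbad => ?_⟩
  set w : S → Fin d := fun i => graphEncoder L m k s n r ω.1 ω.2 i with hw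
  set T : Finset ℕ := S.map Fin.valEmbedding with hT
  -- The default `0` outside `S` is never compared with a digit; it only keeps all values of `W`
  -- below `d`.
  set W : ℕ → ℕ := fun i => if h : ∃ hi : i < n, (⟨i, hi⟩ : Fin n) ∈ S then w ⟨⟨i, h.1⟩, h.2⟩ else 0
    with hW
  have hWi : ∀ i : S, W i = w i := by
    intro i
    simp [hW]
  have hWlt : ∀ i, W i < d := by
    intro i
    simp only [hW]
    split_ifs
    · exact Fin.is_lt _
    · exact hd0
  have hTsub : T ⊆ Finset.range (m + k + s) := by
    intro i hi
    obtain ⟨j, _, rfl⟩ := Finset.mem_map.1 hi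
    rw [← hn]
    exact Finset.mem_range.2 j.2
  have hTcard : T.card = S.card := Finset.card_map _
  have hagree : ∀ c : ℕ, (fun i : S => toWord d n c i) = w ↔ Agrees d T W c := by
    intro c
    constructor
    · intro h i hi
      obtain ⟨j, hj, rfl⟩ := Finset.mem_map.1 hi
      have h1 := congrArg Fin.val (congrFun h ⟨j, hj⟩)
      have h2 := hWi ⟨j, hj⟩
      simp only [toWord, Fin.val_ofNat, Fin.valEmbedding_apply] at h1 h2 ⊢
      rw [h1, h2]
    · intro h
      funext i
      ext
      have h1 := h i (Finset.mem_map_of_mem _ i.2)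
      rw [hWi] at h1
      simpa [toWord] using h1
  have hcount : ∀ x : Fin m → Fin d,
      (∑ z, if (fun i : S => graphEncoder L m k s n r x z i) = w then (1 : ℝ) else 0) =
        agreeCount d N m k s (stepBackNat L) T W (2 ^ r) (wordCode x) := by
    intro x
    unfold agreeCount
    rw [← sum_wordCode fun z => if Agrees d T W (encNat d N m k s (stepBackNat L) (wordCode x) z)
      then (1 : ℝ) else 0]
    refine Finset.sum_congr rfl fun z _ => ?_
    simp only [graphEncoder, hagree]
  set a := (T.filter (· < m + k)).card with ha
  have hfree := freeSteps_add_card (w := W) hd hTsub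
  rw [← ha] at hfree
  set f := ∑ j ∈ Finset.range s,
    if allowedLabels d (m + k) s T W j = Finset.range d then 1 else 0 with hf
  obtain ⟨A, hA, hsum, hη⟩ := sum_abs_agreeCount_sub_le hd hN hN'
    (stepBackNat_coe L) hL.stepBack_bijective (sq_nonneg lam) (by
      intro g hg
      have h1 := G.sum_sq_mulVec_normAdj_le hd0 hlam hgap g hg
      simp only [hL.sum_stepBack, mul_pow]
      rw [← Finset.mul_sum, mul_assoc]
      exact mul_le_mul_of_nonneg_left h1 (by positivity)) hWlt hTsub ha hfree
  obtain ⟨A', hA', hη'⟩ := sum_abs_agreeCount_sub_le_of_range hd0 (R := 2 ^ r) (by positivity) hN'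
    hA hsum hη
  have hle : a ≤ S.card := hTcard ▸ Finset.card_filter_le _ _
  have hle' : a ≤ m + k := by
    have : T.filter (· < m + k) ⊆ Finset.range (m + k) := fun i hi =>
      Finset.mem_range.2 (Finset.mem_filter.1 hi).2
    simpa using Finset.card_le_card this
  have hb := hbound S.card a f hS hle hle' (hTcard ▸ hfree)
  push_cast at hη'
  set η := √(d ^ (3 * k + a) * (lam ^ 2) ^ f) + d ^ (s + 2 * k) / 2 ^ r with hηdef
  have hmsg : ∑ x : Fin m → Fin d, |agreeCount d N m k s (stepBackNat L) T W (2 ^ r) (wordCode x)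
      - A'| ≤ η * (A' * Fintype.card (Fin m → Fin d)) := by
    -- Messages are only the first `d ^ m` of the `N` vertices; the deviations are nonnegative, so
    -- restricting the sum is harmless. This is why errors were measured against `A * d ^ m`.
    rw [sum_wordCode fun v => |agreeCount d N m k s (stepBackNat L) T W (2 ^ r) v - A'|]
    refine le_trans ?_ (hη'.trans (le_of_eq ?_))
    · rw [← Finset.sum_range fun v => |agreeCount d N m k s (stepBackNat L) T W (2 ^ r) v - A'|]
      exact Finset.sum_le_sum_of_subset_of_nonneg (Finset.range_mono hN)
        fun _ _ _ => abs_nonneg _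
    · simp
  have hne : Nonempty (Fin m → Fin d) := ⟨ω.1⟩
  have hst := statDist_uniform_le
    (fun x => agreeCount d N m k s (stepBackNat L) T W (2 ^ r) (wordCode x)) hA'
    (by linarith) hmsg
  have hpost : posterior (graphEncoder L m k s n r) S w =
      fun x => agreeCount d N m k s (stepBackNat L) T W (2 ^ r) (wordCode x) /
        ∑ y : Fin m → Fin d, agreeCount d N m k s (stepBackNat L) T W (2 ^ r) (wordCode y) := by
    funext x
    rw [posterior_eq, hcount]
    congr 1
    exact Finset.sum_congr rfl fun y _ => hcount y
  unfold IsBadObservation at hbad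
  rw [hpost] at hbad
  linarith

end GraphProtocol

/-! ### Asymptotics -/

theorem pow_mul_pow_eq_rpow {d : ℕ} (hd : 2 ≤ d) {θ α : ℝ} (hθ : 0 < θ)
    (hα : α = -Real.logb d θ) (a f : ℕ) :
    (d : ℝ) ^ a * θ ^ f = (d : ℝ) ^ ((a : ℝ) - α * f) := by
  have hd1 : (1 : ℝ) < d := by exact_mod_cast hd
  have hd0 : (0 : ℝ) < d := by linarith
  have h1 : θ = (d : ℝ) ^ (-α) := by
    rw [hα, neg_neg, Real.rpow_logb hd0 hd1.ne' hθ]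
  rw [sub_eq_add_neg, Real.rpow_add hd0, Real.rpow_natCast, ← neg_mul, Real.rpow_mul hd0.le, ← h1,
    Real.rpow_natCast]

/-- Substituting `f = n - m - k - t + a` gives `(1 - α) * a - α * (n - m - k - t)`, increasing in
`a`. Inserting `a ≤ m + k` leads to the condition `ρ < α * (1 - δ)`, and `a ≤ t` to `ρ < 1 - δ / α`.
-/
theorem exponent_le {α δ ρ : ℝ} (hα₀ : 0 < α) (hα₁ : α ≤ 1)
    (hρ : ρ < max (α * (1 - δ)) (1 - δ / α)) (k : ℕ) :
    ∃ γ : ℝ, 0 < γ ∧ ∀ n m s t a f : ℕ, n = m + k + s → (m : ℝ) ≤ ρ * n → (t : ℝ) ≤ δ * n →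
      a ≤ t → a ≤ m + k → f + t = s + a → (a : ℝ) - α * f ≤ k - γ * n := by
  have key : ∀ n m s t a f : ℕ, n = m + k + s → f + t = s + a →
      (f : ℝ) = n - m - k - t + a := by
    intro n m s t a f h1 h2
    have h1' : (n : ℝ) = m + k + s := by exact_mod_cast h1
    have h2' : (f : ℝ) + t = s + a := by exact_mod_cast h2
    linarith
  rcases lt_max_iff.1 hρ with h | h
  · refine ⟨α * (1 - δ) - ρ, by linarith, fun n m s t a f h1 h2 h3 h4 h5 h6 => ?_⟩
    rw [key n m s t a f h1 h6]
    have h5' : (a : ℝ) ≤ m + k := by exact_mod_cast h5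
    have h7 : (1 - α) * (a : ℝ) ≤ (1 - α) * (m + k) :=
      mul_le_mul_of_nonneg_left h5' (by linarith)
    have h8 : α * (t : ℝ) ≤ α * (δ * n) := mul_le_mul_of_nonneg_left h3 hα₀.le
    linarith
  · have h0 : ρ * α < α - δ := by
      have : ρ * α < (1 - δ / α) * α := mul_lt_mul_of_pos_right h hα₀
      rwa [sub_mul, one_mul, div_mul_cancel₀ _ hα₀.ne'] at this
    refine ⟨α - δ - ρ * α, by linarith, fun n m s t a f h1 h2 h3 h4 h5 h6 => ?_⟩
    rw [key n m s t a f h1 h6]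
    have h4' : (a : ℝ) ≤ t := by exact_mod_cast h4
    have h7 : (1 - α) * (a : ℝ) ≤ (1 - α) * t := mul_le_mul_of_nonneg_left h4' (by linarith)
    have h8 : α * (m : ℝ) ≤ α * (ρ * n) := mul_le_mul_of_nonneg_left h2 hα₀.le
    have h9 : α * (k : ℝ) ≤ 1 * k := mul_le_mul_of_nonneg_right hα₁ (Nat.cast_nonneg k)
    linarith

theorem exists_error_exponent {d : ℕ} (hd : 2 ≤ d) {θ α δ ρ : ℝ} (hθ : 0 < θ)
    (hα : α = -Real.logb d θ) (hα₀ : 0 < α) (hα₁ : α ≤ 1)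
    (hρ : ρ < max (α * (1 - δ)) (1 - δ / α)) (k : ℕ) :
    ∃ β : ℝ, 0 < β ∧ ∀ᶠ n : ℕ in atTop, ∀ m s t a f : ℕ, n = m + k + s → (m : ℝ) ≤ ρ * n →
      (t : ℝ) ≤ δ * n → a ≤ t → a ≤ m + k → f + t = s + a →
      √((d : ℝ) ^ (3 * k + a) * θ ^ f) + (d : ℝ) ^ (s + 2 * k) / 2 ^ (d * (n + k) + n) ≤
        (2 : ℝ) ^ (-(β * n)) / 2 := by
  obtain ⟨γ, hγ, hexp⟩ := exponent_le hα₀ hα₁ hρ k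
  have hd1 : (1 : ℝ) < d := by exact_mod_cast hd
  have hd2 : (2 : ℝ) ≤ d := by exact_mod_cast hd
  have hd0 : (0 : ℝ) < d := by linarith
  -- The square root halves `γ`, and the truncation error is at most `2 ^ (-n)`; this explains the
  -- minimum. The last halving keeps a factor `2 ^ (-(β * n))` in reserve to absorb the constant `2
  -- * (d ^ (2 * k) + 1)`.
  set β := min (γ / 2) 1 / 2 with hβ
  have hβ0 : 0 < β := by positivity
  have hβ1 : 2 * β ≤ γ / 2 := by
    have := min_le_left (γ / 2) 1
    linarith
  have hβ2 : 2 * β ≤ 1 := by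
    have := min_le_right (γ / 2) 1
    linarith
  refine ⟨β, hβ0, ?_⟩
  have hlim : Tendsto (fun n : ℕ => (2 : ℝ) ^ (β * n)) atTop atTop :=
    (tendsto_rpow_atTop_of_base_gt_one 2 one_lt_two).comp
      (tendsto_natCast_atTop_atTop.const_mul_atTop hβ0)
  filter_upwards [hlim.eventually_ge_atTop (2 * ((d : ℝ) ^ (2 * k) + 1))]
    with n hn m s t a f h1 h2 h3 h4 h5 h6
  have hx := hexp n m s t a f h1 h2 h3 h4 h5 h6
  have hn0 : (0 : ℝ) ≤ n := Nat.cast_nonneg n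
  have e1 : √((d : ℝ) ^ (3 * k + a) * θ ^ f) ≤ (d : ℝ) ^ (2 * k) * (2 : ℝ) ^ (-(2 * β * n)) := by
    rw [Real.sqrt_le_iff]
    refine ⟨by positivity, ?_⟩
    rw [pow_add, mul_assoc, pow_mul_pow_eq_rpow hd hθ hα]
    have g1 : (d : ℝ) ^ ((a : ℝ) - α * f) ≤ (d : ℝ) ^ ((k : ℝ) - γ * n) :=
      Real.rpow_le_rpow_of_exponent_le hd1.le hx
    have g2 : (d : ℝ) ^ ((k : ℝ) - γ * n) = (d : ℝ) ^ k * (d : ℝ) ^ (-(γ * n)) := by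
      rw [sub_eq_add_neg, Real.rpow_add hd0, Real.rpow_natCast]
    have g3 : (d : ℝ) ^ (-(γ * n)) ≤ (2 : ℝ) ^ (-(γ * n)) :=
      Real.rpow_le_rpow_of_nonpos two_pos hd2 (by
        have := mul_nonneg hγ.le hn0
        linarith)
    have g4 : (2 : ℝ) ^ (-(γ * n)) ≤ ((2 : ℝ) ^ (-(2 * β * n))) ^ 2 := by
      rw [← Real.rpow_mul_natCast two_pos.le]
      refine Real.rpow_le_rpow_of_exponent_le one_le_two ?_
      have := mul_le_mul_of_nonneg_right hβ1 hn0
      push_cast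
      linarith
    calc (d : ℝ) ^ (3 * k) * (d : ℝ) ^ ((a : ℝ) - α * f)
        ≤ (d : ℝ) ^ (3 * k) * ((d : ℝ) ^ k * ((2 : ℝ) ^ (-(2 * β * n))) ^ 2) := by
          refine mul_le_mul_of_nonneg_left (g1.trans (g2.le.trans ?_)) (by positivity)
          exact mul_le_mul_of_nonneg_left (g3.trans g4) (by positivity)
      _ = ((d : ℝ) ^ (2 * k) * (2 : ℝ) ^ (-(2 * β * n))) ^ 2 := by ring
  -- The number of random bits was chosen for this: `d ≤ 2 ^ d` lets `d * (n + k)` bits cover `d ^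
  -- (n + k)`, and the other `n` bits make the error small.
  have e2 : (d : ℝ) ^ (s + 2 * k) / 2 ^ (d * (n + k) + n) ≤ (2 : ℝ) ^ (-(2 * β * n)) := by
    have g1 : (d : ℝ) ^ (s + 2 * k) ≤ 2 ^ (d * (n + k)) := by
      calc (d : ℝ) ^ (s + 2 * k) ≤ (d : ℝ) ^ (n + k) := pow_le_pow_right₀ hd1.le (by omega)
        _ ≤ (2 ^ d) ^ (n + k) := pow_le_pow_left₀ hd0.le
            (by exact_mod_cast (Nat.lt_two_pow_self (n := d)).le) _
        _ = 2 ^ (d * (n + k)) := by rw [pow_mul]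
    calc (d : ℝ) ^ (s + 2 * k) / 2 ^ (d * (n + k) + n)
        ≤ 2 ^ (d * (n + k)) / 2 ^ (d * (n + k) + n) := by gcongr
      _ = (2 : ℝ) ^ (-(n : ℝ)) := by
          rw [pow_add, Real.rpow_neg two_pos.le, Real.rpow_natCast]
          field_simp
      _ ≤ (2 : ℝ) ^ (-(2 * β * n)) := by
          refine Real.rpow_le_rpow_of_exponent_le one_le_two ?_
          have := mul_le_mul_of_nonneg_right hβ2 hn0
          linarith
  have e3 : (2 : ℝ) ^ (-(2 * β * n)) = (2 : ℝ) ^ (-(β * n)) * (2 : ℝ) ^ (-(β * n)) := by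
    rw [← Real.rpow_add two_pos]
    congr 1
    ring
  have e4 : (2 : ℝ) ^ (-(β * n)) * (2 : ℝ) ^ (β * n) = 1 := by
    rw [← Real.rpow_add two_pos, neg_add_cancel, Real.rpow_zero]
  have e5 : 0 < (2 : ℝ) ^ (-(β * n)) := by positivity
  have e6 : (2 : ℝ) ^ (-(β * n)) * (2 * ((d : ℝ) ^ (2 * k) + 1)) ≤ 1 := by
    exact (mul_le_mul_of_nonneg_left hn e5.le).trans e4.le
  calc _ ≤ (d : ℝ) ^ (2 * k) * (2 : ℝ) ^ (-(2 * β * n)) + (2 : ℝ) ^ (-(2 * β * n)) :=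
        add_le_add e1 e2
    _ = (2 : ℝ) ^ (-(β * n)) * ((2 : ℝ) ^ (-(β * n)) * (2 * ((d : ℝ) ^ (2 * k) + 1))) / 2 := by
        rw [e3]
        ring
    _ ≤ (2 : ℝ) ^ (-(β * n)) / 2 := by
        have := mul_le_mul_of_nonneg_left e6 e5.le
        linarith

theorem eventually_rate {p q : ℕ} (hp : 0 < p) (hq : 0 < q) {R : ℝ} (hR : R < p / q)
    (h1 : (p : ℝ) / q < 1) (k : ℕ) :
    ∀ᶠ n : ℕ in atTop, 0 < n * p / q ∧ R ≤ ((n * p / q : ℕ) : ℝ) / n ∧ n * p / q + k ≤ n := by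
  have hqR : (0 : ℝ) < q := by exact_mod_cast hq
  set ρ : ℝ := (p : ℝ) / q with hρ
  have e1 := tendsto_natCast_atTop_atTop (R := ℝ) |>.eventually_ge_atTop (1 / (ρ - R))
  have e2 := tendsto_natCast_atTop_atTop (R := ℝ) |>.eventually_ge_atTop (k / (1 - ρ))
  filter_upwards [e1, e2, eventually_ge_atTop q, eventually_gt_atTop 0] with n g1 g2 g3 g4
  have hnR : (0 : ℝ) < n := by exact_mod_cast g4
  have hfl : ((n * p / q : ℕ) : ℝ) ≤ ρ * n := by
    refine Nat.cast_div_le.trans (le_of_eq ?_)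
    push_cast
    rw [hρ]
    ring
  have hfl' : ρ * n - 1 < ((n * p / q : ℕ) : ℝ) := by
    have h2 : n * p < q * (n * p / q + 1) := Nat.lt_mul_div_succ _ hq
    have h3 : (n : ℝ) * p < q * (((n * p / q : ℕ) : ℝ) + 1) := by exact_mod_cast h2
    have h4 : ρ * n < ((n * p / q : ℕ) : ℝ) + 1 := by
      rw [hρ, div_mul_eq_mul_div, div_lt_iff₀ hqR]
      linarith
    linarith
  refine ⟨Nat.div_pos (g3.trans (Nat.le_mul_of_pos_right _ hp)) hq, ?_, ?_⟩
  · rw [le_div_iff₀ hnR]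
    rw [div_le_iff₀ (by linarith)] at g1
    linarith
  · have : ((n * p / q : ℕ) : ℝ) + k ≤ n := by
      rw [div_le_iff₀ (by linarith)] at g2
      linarith
    exact_mod_cast this

/-! ### Polynomial-time protocols -/

/-- A bound for the bit lengths of the numbers that occur in the computations. -/
def sizeBound (d k p q n : ℕ) : ℕ := d * (n + k + 1) + n + p + q + 1

theorem polyBounded_sizeBound (d k p q : ℕ) : PolyBounded (sizeBound d k p q) :=
  ((((((PolyBounded.const d).mul ((PolyBounded.id.add (.const k)).add (.const 1))).add .id).add
    (.const p)).add (.const q)).add (.const 1))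

theorem pow_lt_sizeBound {d : ℕ} (k p q : ℕ) {n i : ℕ} (hi : i ≤ n + k + 1) :
    d ^ i < 2 ^ sizeBound d k p q n := by
  calc d ^ i ≤ (2 ^ d) ^ i := Nat.pow_le_pow_left (Nat.lt_two_pow_self).le _
    _ = 2 ^ (d * i) := by rw [pow_mul]
    _ ≤ 2 ^ (d * (n + k + 1)) := Nat.pow_le_pow_right two_pos (Nat.mul_le_mul_left _ hi)
    _ < _ := Nat.pow_lt_pow_right one_lt_two (by unfold sizeBound; omega)

theorem lt_sizeBound {d k p q n i : ℕ} (hi : i ≤ n + p + q) : i < 2 ^ sizeBound d k p q n :=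
  (Nat.lt_two_pow_self).trans_le (Nat.pow_le_pow_right two_pos (by unfold sizeBound; omega))

theorem mul_lt_sizeBound {d k p q n : ℕ} : n * p < 2 ^ sizeBound d k p q n := by
  calc n * p < 2 ^ n * 2 ^ p := Nat.mul_lt_mul'' Nat.lt_two_pow_self Nat.lt_two_pow_self
    _ = 2 ^ (n + p) := by rw [pow_add]
    _ ≤ _ := Nat.pow_le_pow_right two_pos (by unfold sizeBound; omega)

/-- Programs that are given the number of vertices `sz n` in register `1` can be turned, with
polynomial overhead, into programs that are given the advice `a n` instead. -/
def SizesReplaceable (B sz a : ℕ → ℕ) : Prop :=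
  ∀ (P : Prog) (l : ℕ), l ≤ 2 → ∃ (P' : Prog) (W : ℕ → ℕ), PolyBounded W ∧ ∀ᶠ n in atTop,
    ∀ (args : List ℕ) (out T : ℕ), args.length = l → (∀ x ∈ args, x < 2 ^ B n) → out < 2 ^ B n →
      P.ComputesWithin (n :: sz n :: args) out T → P'.ComputesWithin (n :: a n :: args) out (W n + T)

theorem sizesReplaceable_self (B sz : ℕ → ℕ) : SizesReplaceable B sz sz := fun P _ _ =>
  ⟨P, fun _ => 0, .const 0, .of_forall fun _ _ _ _ _ _ _ h => h.mono (by omega)⟩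

/-- The argument `d ^ m` of the locating program has bit length linear in `n`, so running it first
costs only a polynomial in `n`. -/
theorem sizesReplaceable_of_locatable {d k p q : ℕ} (hd : 2 ≤ d) {sz : ℕ → ℕ}
    {P : Prog} {pol : Polynomial ℕ} (hk : ∀ᶠ n in atTop, n * p / q + k ≤ n)
    (hsz : ∀ᶠ n in atTop, sz n ≤ d ^ (n * p / q + k))
    (hP : ∀ᶠ n in atTop, P.ComputesWithin [d ^ (n * p / q)] (sz n)
      (pol.eval (Nat.size (d ^ (n * p / q))))) :
    SizesReplaceable (sizeBound d k p q) sz fun _ => 0 := by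
  have hB := polyBounded_sizeBound d k p q
  refine fun P' l hl => ⟨withLocatedSize p q d P P' (List.range (l + 2)),
    fun n => pol.eval (sizeBound d k p q n) + (n + 20) * (3 * (sizeBound d k p q n + 1) ^ 2),
    (hB.eval pol).add ((PolyBounded.id.add (.const 20)).mul
      ((PolyBounded.const 3).mul ((hB.add (.const 1)).pow 2))), ?_⟩
  filter_upwards [hk, hsz, hP] with n h1 h2 h3 args out T hargs hlt hout hrun
  subst hargs
  have hd0 : 0 < d := by omega
  refine (withLocatedSize_spec hd rfl (pow_lt_sizeBound k p q (by omega))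
    (lt_sizeBound (by omega)) mul_lt_sizeBound (lt_sizeBound (by omega)) (lt_sizeBound (by omega))
    (h2.trans_lt (pow_lt_sizeBound k p q (by omega))) hout hlt h3 hl hrun).mono ?_
  have g1 : pol.eval (Nat.size (d ^ (n * p / q))) ≤ pol.eval (sizeBound d k p q n) :=
    pol.eval_mono_nat (Nat.size_le.2 (pow_lt_sizeBound k p q (by omega)))
  have g2 : (n * p / q + 20) * (3 * (sizeBound d k p q n + 1) ^ 2) ≤
      (n + 20) * (3 * (sizeBound d k p q n + 1) ^ 2) := Nat.mul_le_mul_right _ (by omega)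
  omega

theorem hasWiretapProtocols_of_sizes {d k p q : ℕ} (hd : 2 ≤ d) (hp : 0 < p) (hq : 0 < q)
    {δ R lam α : ℝ} (hlam : lam < 1) (hlam₀ : 0 < lam ^ 2) (hα : α = -Real.logb d (lam ^ 2))
    (hα₀ : 0 < α) (hα₁ : α ≤ 1) (hR : R < p / q) (hpq : (p : ℝ) / q < 1)
    (hρ : (p : ℝ) / q < max (α * (1 - δ)) (1 - δ / α))
    {S : Set ℕ} {G : ∀ N, RegularGraph d N} (hgap : ∀ N ∈ S, 1 - lam ≤ (G N).spectralGap)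
    {L : ∀ N, Fin N → Fin d → Fin N} (hL : ∀ N ∈ S, (G N).IsConsistentLabeling (L N))
    {P : Prog} {pL : Polynomial ℕ} (hP : ∀ N ∈ S, ∀ (u : Fin N) (t : Fin d),
      P.ComputesWithin [N, u, t] (L N u t) (pL.eval (Nat.size N)))
    {sz a : ℕ → ℕ} (hsz : ∀ᶠ n in atTop, sz n ∈ S ∧ d ^ (n * p / q) ≤ sz n ∧
      sz n ≤ d ^ (n * p / q + k))
    (ha : ∀ᶠ n in atTop, Nat.size (a n) ≤ sizeBound d k p q n)
    (hrep : SizesReplaceable (sizeBound d k p q) sz a) : HasWiretapProtocols d δ R a := by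
  have hd0 : 0 < d := by omega
  have hNeZero : NeZero d := ⟨by omega⟩
  have hrate := eventually_rate hp hq hR hpq k
  set m : ℕ → ℕ := fun n => n * p / q with hm
  set s : ℕ → ℕ := fun n => n - (m n + k) with hs
  set r : ℕ → ℕ := fun n => d * (n + k) + n with hr
  set B := sizeBound d k p q with hB
  have hBp : PolyBounded B := polyBounded_sizeBound d k p q
  refine ⟨m, r, fun n => graphEncoder (L (sz n)) (m n) k (s n) n (r n),
    fun n => graphDecoder (L (sz n)) (m n) k (s n) n, ?_, ?_⟩
  · obtain ⟨PE, WE, hWE, hPE⟩ := hrep (encProg p q k d P) 2 le_rfl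
    obtain ⟨PD, WD, hWD, hPD⟩ := hrep (decProg p q k d P) 1 one_le_two
    set TE : ℕ → ℕ := fun n => (n + 1) * ((d + 5) * (2 * pL.eval (B n) + 15 * (B n + 2) ^ 2) +
      10 * (B n + 2) ^ 2) + (n + 30) * (3 * (B n + 2) ^ 2) with hTE
    set TD : ℕ → ℕ := fun n => (n + 1) * (pL.eval (B n) + 10 * (B n + 2) ^ 2) +
      (n + 30) * (3 * (B n + 2) ^ 2) with hTD
    have hB2 : PolyBounded fun n => (B n + 2) ^ 2 := (hBp.add (.const 2)).pow 2
    have hTEp : PolyBounded TE :=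
      ((PolyBounded.id.add (.const 1)).mul (((PolyBounded.const (d + 5)).mul
        (((PolyBounded.const 2).mul (hBp.eval pL)).add ((PolyBounded.const 15).mul hB2))).add
        ((PolyBounded.const 10).mul hB2))).add
        ((PolyBounded.id.add (.const 30)).mul ((PolyBounded.const 3).mul hB2))
    have hTDp : PolyBounded TD :=
      ((PolyBounded.id.add (.const 1)).mul ((hBp.eval pL).add ((PolyBounded.const 10).mul hB2))).add
        ((PolyBounded.id.add (.const 30)).mul ((PolyBounded.const 3).mul hB2))
    obtain ⟨Q, hQ⟩ := (hBp.add ((hWE.add hTEp).add (hWD.add hTDp)))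
    refine ⟨PE, PD, Q.comp (Polynomial.C q * (Polynomial.X + 1)), ?_⟩
    filter_upwards [hrate, hsz, ha, hPE, hPD] with n h1 h2 h3 h4 h5
    obtain ⟨hS, hN, hN'⟩ := h2
    obtain ⟨-, -, hmk⟩ := h1
    have hmk' : m n + k ≤ n := hmk
    have hn : n = m n + k + s n := by simp only [hs]; omega
    -- Running times must be polynomial in `m`, not `n`; the positive rate makes the two linearly
    -- related.
    have hnm : n ≤ q * (m n + 1) :=
      (Nat.le_mul_of_pos_right n hp).trans (Nat.lt_mul_div_succ (n * p) hq).le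
    have hQ' : B n + ((WE n + TE n) + (WD n + TD n)) ≤
        (Q.comp (Polynomial.C q * (Polynomial.X + 1))).eval (m n) := by
      refine (hQ n).trans ((Q.eval_mono_nat hnm).trans (le_of_eq ?_))
      simp
    have hsn : s n ≤ n := Nat.sub_le _ _
    have hmn : m n ≤ n := by omega
    have hNpos : 0 < sz n := (Nat.pow_pos hd0).trans_le hN
    have hNB : sz n < 2 ^ B n := hN'.trans_lt (pow_lt_sizeBound k p q (by omega))
    have hpB : p < 2 ^ B n := lt_sizeBound (by omega)
    have hqB : q < 2 ^ B n := lt_sizeBound (by omega)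
    have hlab : ∀ u < sz n, ∀ t < d, P.ComputesWithin [sz n, u, t] (stepNat (L (sz n)) u t)
        (pL.eval (B n)) ∧ stepNat (L (sz n)) u t < sz n := by
      intro u hu t ht
      refine ⟨?_, stepNat_lt _ hu t⟩
      have := (hP _ hS ⟨u, hu⟩ ⟨t, ht⟩).mono (pL.eval_mono_nat (Nat.size_le.2 hNB))
      have e : Fin.ofNat d t = ⟨t, ht⟩ := by
        ext
        simp [Nat.mod_eq_of_lt ht]
      rw [stepNat, dif_pos hu, e]
      exact this
    have hcode : ∀ y : Fin n → Fin d, wordCode y < 2 ^ B n := fun y =>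
      (wordCode_lt y).trans (pow_lt_sizeBound k p q (by omega))
    have hmsg : ∀ x : Fin (m n) → Fin d, wordCode x < 2 ^ B n := fun x =>
      (wordCode_lt x).trans (pow_lt_sizeBound k p q (by omega))
    have hcons := hL _ hS
    refine ⟨by omega, ?_, fun x z => ?_, fun y => ?_⟩
    · refine le_trans ?_ ((Nat.le_add_right _ _).trans hQ')
      simp only [hr, hB, sizeBound, mul_add]
      omega
    · have hz : wordCode z < 2 ^ B n := by
        refine (wordCode_lt z).trans_le (Nat.pow_le_pow_right two_pos ?_)
        simp only [hr, hB, sizeBound, mul_add]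
        omega
      have henc := encProg_spec (s := s n) hd rfl hn (pow_lt_sizeBound k p q le_rfl)
        mul_lt_sizeBound hpB hqB hN' hlab (fun t _ u hu => hcons.stepBackNat_stepNat t hu)
        (fun t _ v hv => stepBackNat_lt _ t hv) (fun t _ v hv => hcons.exists_stepNat_stepNat t hv)
        ((wordCode_lt x).trans_le hN) hz
      rw [← wordCode_graphEncoder hn hN hN'] at henc
      refine (h4 [wordCode x, wordCode z] _ _ rfl ?_ (hcode _) henc).mono (le_trans ?_ hQ')
      · simpa using ⟨hmsg x, hz⟩
      · have : (s n + 1) * ((d + 5) * (2 * pL.eval (B n) + 15 * (B n + 2) ^ 2) +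
            10 * (B n + 2) ^ 2) + (m n + 30) * (3 * (B n + 2) ^ 2) ≤ TE n :=
          Nat.add_le_add (Nat.mul_le_mul_right _ (by omega)) (Nat.mul_le_mul_right _ (by omega))
        exact (Nat.add_le_add_left this _).trans (by omega)
    · have hdec := decProg_spec (s := s n) hd rfl hn (pow_lt_sizeBound k p q le_rfl)
        mul_lt_sizeBound hpB hqB hNpos hN' hlab (wordCode_lt y)
      rw [← wordCode_graphDecoder] at hdec
      refine (h5 [wordCode y] _ _ rfl ?_ (hmsg _) hdec).mono (le_trans ?_ hQ')
      · simpa using hcode y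
      · have : (s n + 1) * (pL.eval (B n) + 10 * (B n + 2) ^ 2) +
            (m n + 30) * (3 * (B n + 2) ^ 2) ≤ TD n :=
          Nat.add_le_add (Nat.mul_le_mul_right _ (by omega)) (Nat.mul_le_mul_right _ (by omega))
        exact (Nat.add_le_add_left this _).trans (by omega)
  · obtain ⟨β, hβ, herr⟩ := exists_error_exponent hd hlam₀ hα hα₀ hα₁ hρ k
    refine ⟨β, hβ, ?_⟩
    filter_upwards [hrate, hsz, herr] with n h1 h2 h3
    obtain ⟨hm0, hRm, hmk⟩ := h1
    obtain ⟨hS, hN, hN'⟩ := h2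
    have hmk' : m n + k ≤ n := hmk
    have hn : n = m n + k + s n := by simp only [hs]; omega
    have hmn : ((m n : ℕ) : ℝ) ≤ p / q * n := by
      refine Nat.cast_div_le.trans (le_of_eq ?_)
      push_cast
      ring
    refine ⟨hm0, hRm, isResilientWiretap_graph hd hlam (hgap _ hS) (hL _ hS) hn hN hN' ?_
      fun t a f ht ha ha' hf => h3 (m n) (s n) t a f hn hmn ht ha ha' hf⟩
    refine Real.rpow_le_one_of_one_le_of_nonpos one_le_two ?_
    have : 0 ≤ β * n := by positivity
    linarith

/-- `S` contains arbitrarily large sizes, so the term `1 / N` in `inv_sub_inv_le_sq` tends to zero.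
The result yields `α ≤ 1` and excludes `lam = 0`, for which the logarithm would be meaningless. -/
theorem one_div_le_sq_of_hasAllSizesUpTo {d : ℕ} (hd : 2 ≤ d) {lam c : ℝ} (hlam : lam < 1)
    {S : Set ℕ} {G : ∀ N, RegularGraph d N} (hgap : ∀ N ∈ S, 1 - lam ≤ (G N).spectralGap)
    (hS : HasAllSizesUpTo S c) : 1 / (d : ℝ) ≤ lam ^ 2 := by
  refine le_of_forall_pos_lt_add fun ε hε => ?_
  obtain ⟨M, ⟨N, hN, hMN, -⟩, hM⟩ := (hS.and
    ((tendsto_natCast_atTop_atTop (R := ℝ)).eventually_gt_atTop (1 / ε))).exists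
  have h1 : 1 / ε < N := hM.trans_le (by exact_mod_cast hMN)
  have hN0 : (0 : ℝ) < N := lt_trans (by positivity) h1
  have h2 := (G N).inv_sub_inv_le_sq (by omega) (by exact_mod_cast hN0) hlam (hgap N hN)
  have h3 : 1 / (N : ℝ) < ε := by
    rw [div_lt_iff₀ hN0]
    rw [div_lt_iff₀ hε] at h1
    linarith
  linarith

theorem mainTheorem5 (d : ℕ) (hd : 2 ≤ d) (δ γ lam c : ℝ) (hδ₀ : 0 ≤ δ) (hδ₁ : δ < 1)
    (hγ : 0 < γ) (hlam : lam < 1) (hc : 1 ≤ c)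
    (S : Set ℕ) (G : ∀ N, RegularGraph d N)
    (hG : IsConstructible S G)
    (hgap : ∀ N ∈ S, 1 - lam ≤ (G N).spectralGap)
    (hS : HasAllSizesUpTo S c)
    (α R : ℝ) (hα : α = -Real.logb d (lam ^ 2))
    (hR : R = max (α * (1 - δ)) (1 - δ / α) - γ) :
    (∃ a : ℕ → ℕ, HasWiretapProtocols d δ R a) ∧
      (SizesLocatable S c → HasWiretapProtocols d δ R fun _ => 0) := by
  have hd0 : 0 < d := by omega
  have hdR : (1 : ℝ) < d := by exact_mod_cast hd
  have hdR0 : (0 : ℝ) < d := by linarith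
  have hsq := one_div_le_sq_of_hasAllSizesUpTo hd hlam hgap hS
  have hlam₀ : 0 < lam ^ 2 := lt_of_lt_of_le (by positivity) hsq
  have hlam_nonneg : 0 ≤ lam := by
    obtain ⟨M, N, hN, -⟩ := hS.exists
    exact (G N).nonneg_of_le_spectralGap (hgap N hN)
  have hα₀ : 0 < α := by
    have : Real.logb d (lam ^ 2) < 0 :=
      Real.logb_neg hdR hlam₀ (pow_lt_one₀ hlam_nonneg hlam two_ne_zero)
    linarith
  have hα₁ : α ≤ 1 := by
    have h1 : Real.logb d (1 / d) ≤ Real.logb d (lam ^ 2) :=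
      Real.logb_le_logb_of_le hdR (by positivity) hsq
    rw [one_div, Real.logb_inv, Real.logb_self_eq_one hdR] at h1
    linarith
  have hmax_pos : 0 < max (α * (1 - δ)) (1 - δ / α) :=
    lt_max_of_lt_left (mul_pos hα₀ (by linarith))
  have hmax_le : max (α * (1 - δ)) (1 - δ / α) ≤ 1 := by
    refine max_le ?_ ?_
    · nlinarith
    · have : 0 ≤ δ / α := by positivity
      linarith
  -- A rational rate allows `m` to be computed by integer arithmetic. Taking it above `0` as well as
  -- above `R` covers a negative `R`; the slack on both sides absorbs rounding and the constant `k`.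
  obtain ⟨ρ, hρ₁, hρ₂⟩ := exists_rat_btwn (max_lt hmax_pos (by linarith : R < _))
  have hρ₀ : (0 : ℝ) < ρ := (le_max_left _ _).trans_lt hρ₁
  have hR' : R < ρ := (le_max_right _ _).trans_lt hρ₁
  have hρnum : 0 < ρ.num := Rat.num_pos.2 (by exact_mod_cast hρ₀)
  obtain ⟨p, hp⟩ := Int.eq_ofNat_of_zero_le hρnum.le
  obtain ⟨q, hq⟩ : ∃ q, q = ρ.den := ⟨_, rfl⟩
  have hp0 : 0 < p := by omega
  have hq0 : 0 < q := hq ▸ ρ.den_pos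
  have hρ : (ρ : ℝ) = p / q := by
    rw [Rat.cast_def, hp, hq]
    simp
  rw [hρ] at hρ₂ hR'
  obtain ⟨k, hk⟩ := pow_unbounded_of_one_lt c hdR
  obtain ⟨L, hL, P, pL, hP⟩ := hG
  have hpow : Tendsto (fun n : ℕ => d ^ (n * p / q)) atTop atTop := by
    refine (tendsto_pow_atTop_atTop_of_one_lt (by omega : 1 < d)).comp ?_
    refine (Nat.tendsto_div_const_atTop hq0.ne').comp ?_
    exact tendsto_id.atTop_mul_const' hp0
  have hle : ∀ n N : ℕ, (N : ℝ) ≤ c * (d ^ (n * p / q) : ℕ) → N ≤ d ^ (n * p / q + k) := by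
    intro n N h
    have : (N : ℝ) ≤ (d : ℝ) ^ (n * p / q + k) := by
      refine h.trans ?_
      push_cast
      rw [pow_add, mul_comm]
      exact mul_le_mul_of_nonneg_left hk.le (by positivity)
    exact_mod_cast this
  have hrate := eventually_rate hp0 hq0 hR' (hρ₂.trans_le hmax_le) k
  constructor
  · have hex : ∀ n, ∃ N, (∃ N' ∈ S, d ^ (n * p / q) ≤ N' ∧ (N' : ℝ) ≤ c * (d ^ (n * p / q) : ℕ)) →
        N ∈ S ∧ d ^ (n * p / q) ≤ N ∧ N ≤ d ^ (n * p / q + k) := by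
      intro n
      by_cases h : ∃ N' ∈ S, d ^ (n * p / q) ≤ N' ∧ (N' : ℝ) ≤ c * (d ^ (n * p / q) : ℕ)
      · obtain ⟨N, h1, h2, h3⟩ := h
        exact ⟨N, fun _ => ⟨h1, h2, hle n N h3⟩⟩
      · exact ⟨0, fun h' => absurd h' h⟩
    choose sz hsz using hex
    have hsz' := (hpow.eventually hS).mono fun n h => hsz n h
    refine ⟨sz, hasWiretapProtocols_of_sizes (k := k) hd hp0 hq0 hlam hlam₀ hα hα₀ hα₁ hR'
      (hρ₂.trans_le hmax_le) hρ₂ hgap hL hP hsz' ?_ (sizesReplaceable_self _ _)⟩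
    filter_upwards [hsz', hrate] with n h1 h2
    exact Nat.size_le.2 (h1.2.2.trans_lt (pow_lt_sizeBound k p q (by omega)))
  · rintro ⟨loc, Q, pol, hloc⟩
    have hloc' := hpow.eventually hloc
    have hsz : ∀ᶠ n in atTop, loc (d ^ (n * p / q)) ∈ S ∧ d ^ (n * p / q) ≤ loc (d ^ (n * p / q)) ∧
        loc (d ^ (n * p / q)) ≤ d ^ (n * p / q + k) :=
      hloc'.mono fun n h => ⟨h.1.1, h.1.2.1, hle n _ h.1.2.2⟩
    exact hasWiretapProtocols_of_sizes (k := k) (sz := fun n => loc (d ^ (n * p / q))) hd hp0 hq0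
      hlam hlam₀ hα hα₀ hα₁ hR' (hρ₂.trans_le hmax_le) hρ₂ hgap hL hP hsz
      (.of_forall fun n => by simp) (sizesReplaceable_of_locatable hd (hrate.mono fun n h => h.2.2)
        (hsz.mono fun n h => h.2.2) (hloc'.mono fun n h => h.2))
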